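/- Let $n$ be the dimension, $\|\cdot\|$ the Euclidean norm, and let $m>2$, $k_1,k_2,k_3,k_4>0$ satisfy $$m^2k_3k_4>\Big(\frac{m^3k_3}{m-1}+(4m^2-4m+1)k_1^2\Big)k_2^2 .$$ Let $\kappa>0$, $\varepsilon>0$, $\ell>0$. For $t\ge 0$ consider, for $x_1(t),x_2(t)\in\mathbb R^n$ and $L_0(t)\in\mathbb{R}$, the system $$\dot x_1=-L_1(t)\frac{x_1}{\|x_1\|^{1/m}}-L_2(t)x_1+x_2,\qquad \dot x_2=-L_3(t)\frac{x_1}{\|x_1\|^{2/m}}-L_4(t)x_1+d(t),$$ where the quotients are read as $0$ at $x_1=0$, with the adaptive gains $$L_1=k_1L_0^{(m-1)/m},\quad L_2=k_2L_0,\quad L_3=k_3L_0^{(2m-2)/m},\quad L_4=k_4L_0^2,$$ where $L_0(0)=\ell$ and $\dot L_0=\kappa$ if $\|x_1\|\ge\varepsilon$, $\dot L_0=0$ otherwise. Solutions are understood in the sense of Filippov on $[0,\infty)$: $x_1,x_2,L_0$ are locally absolutely continuous and satisfy the equations for almost every $t\ge0$, where at instants with $\|x_1(t)\|=\varepsilon$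 any value $\dot L_0(t)\in[0,\kappa]$ is allowed. For $c_1,c_2>0$ and $p\in(0,1)$ put $$T_{c_1,c_2,p}(r)=\frac{\ln\left(1+c_2r^{1-p}/c_1\right)}{c_2(1-p)},\qquad r_0=\big(\|x_1(0)\|^2+\|x_2(0)\|^2\big)^{1/2}.$$ (i) (Fast finite-time convergence.) If $d=0$, there are constants $c_1,c_2>0$ and $p\in(0,1)$, independent of the solution, such that every solution satisfies $x_1(t)=0$ and $\dot x_1(t)=0$ for all $t\ge T_{c_1,c_2,p}(r_0)$. (ii) (Fast finite-time uniform ultimate boundedness.) For every $\delta\ge0$ there are constants $b,c_1,c_2>0$ and $p\in(0,1)$, independent of the disturbance and of the solution, such that for every disturbance $d$ with $\|d(t)\|\le\delta$ for all $t\ge0$, every solution satisfies $\|x_1(t)\|\le b$ and $\|\dot x_1(t)\|\le b$ for all $t\ge T_{c_1,c_2,p}(r_0)$. -/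

import Mathlib

open MeasureTheory

noncomputable section

/-- The adaptive gain `L₁ = k₁ L₀^((m-1)/m)`. -/
def gain1 (m k₁ L₀ : ℝ) : ℝ := k₁ * L₀ ^ ((m - 1) / m)

/-- The adaptive gain `L₂ = k₂ L₀`. -/
def gain2 (k₂ L₀ : ℝ) : ℝ := k₂ * L₀

/-- The adaptive gain `L₃ = k₃ L₀^((2m-2)/m)`. -/
def gain3 (m k₃ L₀ : ℝ) : ℝ := k₃ * L₀ ^ ((2 * m - 2) / m)

/-- The adaptive gain `L₄ = k₄ L₀²`. -/
def gain4 (k₄ L₀ : ℝ) : ℝ := k₄ * L₀ ^ 2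

/-- The values that Filippov's convention allows for the derivative of `L₀` when `‖x₁‖ = r`: the
adaptation law prescribes `κ` if `r ≥ ε` and `0` if `r < ε`; at the switching surface `r = ε` the
whole interval `[0, κ]` (which contains the prescribed value `κ`) is allowed. -/
def adaptationRate (κ ε r : ℝ) : Set ℝ :=
  {v | v ∈ Set.Icc 0 κ ∧ (ε < r → v = κ) ∧ (r < ε → v = 0)}

/-- `(x₁, x₂, L₀)` is a solution on `[0, ∞)`, in the sense of Filippov, of the closed-loop system
with disturbance `d`: the three functions are locally absolutely continuous and satisfy, for almost
every `t ≥ 0`, the two state equations and the adaptation law. At `x₁ = 0` the terms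
`x₁ / ‖x₁‖^(1/m)` and `x₁ / ‖x₁‖^(2/m)` take the value `0`, their continuous extension (`m > 2`). -/
structure IsAdaptiveSolution {n : ℕ} (m k₁ k₂ k₃ k₄ κ ε : ℝ)
    (d x₁ x₂ : ℝ → EuclideanSpace ℝ (Fin n)) (L₀ : ℝ → ℝ) : Prop where
  ac_x₁ : ∀ T : ℝ, 0 ≤ T → AbsolutelyContinuousOnInterval x₁ 0 T
  ac_x₂ : ∀ T : ℝ, 0 ≤ T → AbsolutelyContinuousOnInterval x₂ 0 T
  ac_L₀ : ∀ T : ℝ, 0 ≤ T → AbsolutelyContinuousOnInterval L₀ 0 T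
  deriv_x₁ : ∀ᵐ t : ℝ, 0 ≤ t →
    HasDerivAt x₁
      (-(gain1 m k₁ (L₀ t) • (‖x₁ t‖ ^ (1 / m))⁻¹ • x₁ t) - gain2 k₂ (L₀ t) • x₁ t + x₂ t) t
  deriv_x₂ : ∀ᵐ t : ℝ, 0 ≤ t →
    HasDerivAt x₂
      (-(gain3 m k₃ (L₀ t) • (‖x₁ t‖ ^ (2 / m))⁻¹ • x₁ t) - gain4 k₄ (L₀ t) • x₁ t + d t) t
  deriv_L₀ : ∀ᵐ t : ℝ, 0 ≤ t → ∃ v ∈ adaptationRate κ ε ‖x₁ t‖, HasDerivAt L₀ v t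

/-- The settling time of fast finite-time convergence,
`ln (1 + c₂ r^(1-p) / c₁) / (c₂ (1-p))`, where `r` is the size of the initial state: it is the time
in which a solution of `v' = -c₁ v^p - c₂ v`, `v(0) = r`, reaches `0`. -/
def fastSettlingTime (c₁ c₂ p r : ℝ) : ℝ :=
  Real.log (1 + c₂ * r ^ (1 - p) / c₁) / (c₂ * (1 - p))

/-- The Euclidean norm of the stacked state `(y₁, y₂)`. -/
def stateNorm {n : ℕ} (y₁ y₂ : EuclideanSpace ℝ (Fin n)) : ℝ :=
  Real.sqrt (‖y₁‖ ^ 2 + ‖y₂‖ ^ 2)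

end

/-!
In the coordinates `z₁ = L₀ x₁`, `z₂ = x₂` the gain only sets the time scale: with `θ = 1 / m`,

  `z₁' = L₀ (z₂ - (k₁ ‖z₁‖ ^ (-θ) + k₂) z₁) + (L₀' / L₀) z₁`,
  `z₂' = -L₀ (k₃ ‖z₁‖ ^ (-2θ) + k₄) z₁ + d`.

The nominal part has the energy `E`, kinetic plus potential, which is `C¹` because `2 - 2θ > 1` and
which is dissipated through `z₁` only. Subtracting the cross term `μ (1 + E ^ (-γ)) ⟪z₁, z₂⟫` with
`γ = θ / (2 - 2θ)` makes the decay strict: this term scales like `E` near the origin and at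
infinity, so for small `μ` the corrected function `V` is comparable to `E` and decays at the rate
`L₀ (V + V ^ (1 - γ))` (`exists_lyapunov_decay`).

The drift `(L₀' / L₀) z₁` of the gain contributes at most `6 (L₀' / L₀) V`. The weight `exp (A / L₀)`
absorbs it: while `L₀` is small the derivative of the weight wins, and once `L₀` is large the nominal
decay does. As `L₀ ≥ ℓ`, the weight stays between `1` and `exp (A / ℓ)`. A disturbance of size `δ`
contributes a multiple of `δ √V`, which matters only below a threshold. So `W = exp (A / L₀) V`
satisfies `W' ≤ -a (W + W ^ (1 - γ))` above a threshold that vanishes with `δ` (`weighted_decay`), and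
`log (1 + W ^ γ)` decreases there at a constant rate (`IsAdaptiveSolution.timeToGo_le`). The bound
`W ^ γ ≤ K r ^ θ (1 + r ^ θ)` for an initial state of size `r` turns this into the settling time with
exponent `p = 1 - θ` (`timeToGo_div_le_fastSettlingTime`).

Solutions are only absolutely continuous, and `V` is `C¹` only away from the origin. Along a stretch
on which `W` is positive the composition is absolutely continuous, by compactness, so that the
fundamental theorem of calculus applies; the comparison lemma `le_of_decreasing_above` needs no more.
-/

open Set Filter Topology

/-! ### Absolutely continuous curves -/

theorem AbsolutelyContinuousOnInterval.prodMk {X Y : Type*} [PseudoMetricSpace X]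
    [PseudoMetricSpace Y] {f : ℝ → X} {g : ℝ → Y} {a b : ℝ}
    (hf : AbsolutelyContinuousOnInterval f a b) (hg : AbsolutelyContinuousOnInterval g a b) :
    AbsolutelyContinuousOnInterval (fun t => (f t, g t)) a b := by
  refine squeeze_zero (fun E => Finset.sum_nonneg fun i _ => dist_nonneg) (fun E => ?_)
    (by simpa using Tendsto.add hf hg)
  rw [← Finset.sum_add_distrib]
  refine Finset.sum_le_sum fun i _ => ?_
  rw [Prod.dist_eq]
  exact max_le (le_add_of_nonneg_right dist_nonneg) (le_add_of_nonneg_left dist_nonneg)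

theorem LipschitzOnWith.comp_absolutelyContinuousOnInterval {X Y : Type*} [PseudoMetricSpace X]
    [PseudoMetricSpace Y] {K : NNReal} {φ : X → Y} {s : Set X} {f : ℝ → X} {a b : ℝ}
    (hφ : LipschitzOnWith K φ s) (hf : AbsolutelyContinuousOnInterval f a b)
    (hs : ∀ t ∈ uIcc a b, f t ∈ s) :
    AbsolutelyContinuousOnInterval (fun t => φ (f t)) a b := by
  refine squeeze_zero' (Eventually.of_forall fun E => Finset.sum_nonneg fun i _ => dist_nonneg) ?_
    (by simpa using Tendsto.const_mul (K : ℝ) hf)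
  rw [eventually_inf_principal]
  filter_upwards with E hE
  rw [Finset.mul_sum]
  exact Finset.sum_le_sum fun i hi =>
    hφ.dist_le_mul _ (hs _ (hE.1 i hi).1) _ (hs _ (hE.1 i hi).2)

/-- A function that is `C¹` near every point of an absolutely continuous curve is Lipschitz on the
curve, by compactness; so it is absolutely continuous along it. -/
theorem AbsolutelyContinuousOnInterval.comp_of_contDiffAt {G : Type*} [NormedAddCommGroup G]
    [NormedSpace ℝ G] {Φ : G → ℝ} {f : ℝ → G} {a b : ℝ}
    (hf : AbsolutelyContinuousOnInterval f a b)
    (hΦ : ∀ t ∈ uIcc a b, ContDiffAt ℝ 1 Φ (f t)) :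
    AbsolutelyContinuousOnInterval (fun t => Φ (f t)) a b := by
  have hloc : LocallyLipschitzOn (f '' uIcc a b) Φ := by
    rintro _ ⟨t, ht, rfl⟩
    obtain ⟨K, s, hs, hK⟩ := (hΦ t ht).exists_lipschitzOnWith
    exact ⟨K, s, mem_nhdsWithin_of_mem_nhds hs, hK⟩
  obtain ⟨K, hK⟩ := LocallyLipschitzOn.exists_lipschitzOnWith_of_compact
    (isCompact_uIcc.image_of_continuousOn hf.continuousOn) hloc
  exact hK.comp_absolutelyContinuousOnInterval hf fun t ht => mem_image_of_mem f ht

theorem AbsolutelyContinuousOnInterval.sub_le_mul_of_ae_hasDerivAt_le {f : ℝ → ℝ} {a b c : ℝ}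
    (hf : AbsolutelyContinuousOnInterval f a b) (hab : a ≤ b)
    (h : ∀ᵐ t : ℝ, t ∈ Icc a b → ∃ v ≤ c, HasDerivAt f v t) :
    f b - f a ≤ c * (b - a) := by
  rw [← hf.integral_deriv_eq_sub]
  have : ∫ _ in a..b, c = c * (b - a) := by simp [mul_comm]
  rw [← this]
  refine intervalIntegral.integral_mono_ae_restrict hab hf.intervalIntegrable_deriv (by simp) ?_
  rw [EventuallyLE, ae_restrict_iff' measurableSet_Icc]
  filter_upwards [h] with t ht hmem
  obtain ⟨v, hv, hd⟩ := ht hmem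
  rwa [hd.deriv]

/-- If the almost everywhere derivative of an absolutely continuous curve agrees with a continuous
function, then the curve is `C¹` with that function as its derivative. -/
theorem hasDerivWithinAt_of_ae_of_continuousOn {F : Type*} [NormedAddCommGroup F]
    [NormedSpace ℝ F] [CompleteSpace F] {f g : ℝ → F}
    (hf : ∀ T : ℝ, 0 ≤ T → AbsolutelyContinuousOnInterval f 0 T)
    (hg : ContinuousOn g (Ici 0)) (h : ∀ᵐ t : ℝ, 0 ≤ t → HasDerivAt f (g t) t)
    {t : ℝ} (ht : 0 ≤ t) : HasDerivWithinAt f (g t) (Ici 0) t := by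
  -- `G` extends `g` to a continuous function on the line.
  set G : ℝ → F := fun s => g (max s 0) with hG
  have hGc : Continuous G :=
    hg.comp_continuous (by fun_prop) fun s => le_max_right s 0
  have hGg : ∀ s, 0 ≤ s → G s = g s := fun s hs => by simp [hG, hs]
  set P : ℝ → F := fun s => ∫ r in (0 : ℝ)..s, G r with hP
  have hPd : ∀ s, HasDerivAt P (G s) s := fun s => hGc.integral_hasStrictDerivAt 0 s |>.hasDerivAt
  have hPC : ContDiff ℝ 1 P := by
    rw [contDiff_one_iff_deriv]
    refine ⟨fun s => (hPd s).differentiableAt, ?_⟩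
    have : deriv P = G := funext fun s => (hPd s).deriv
    rwa [this]
  have key : ∀ s, 0 ≤ s → f s = f 0 + P s := by
    intro s hs
    obtain ⟨C, hC⟩ := ((hf s hs).fun_sub
      hPC.contDiffOn.absolutelyContinuousOnInterval).const_of_ae_hasDerivAt_zero (by
        filter_upwards [h] with r hr hmem
        rw [uIcc_of_le hs] at hmem
        have := (hr hmem.1).fun_sub (hPd r)
        rwa [hGg r hmem.1, sub_self] at this)
    have h0 := hC 0 left_mem_uIcc
    have h1 := hC s right_mem_uIcc
    have hP0 : P 0 = 0 := by simp [hP]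
    rw [hP0, sub_zero] at h0
    rw [h0, ← h1]; abel
  have := ((hPd t).const_add (f 0)).hasDerivWithinAt (s := Ici 0)
  rw [hGg t ht] at this
  exact this.congr (fun s hs => key s hs) (key t ht)

/-! ### Comparison -/

/-- If `S ∘ f` decreases at rate at least `α` on every interval on which `f` exceeds `B`, then
`f ≤ B` from time `S (f 0) / α` on. Here `S` is a time-to-go function: it vanishes at `0` and is
strictly increasing. -/
theorem le_of_decreasing_above {f S : ℝ → ℝ} {B α : ℝ} (hB : 0 ≤ B) (hα : 0 < α)
    (hf : ContinuousOn f (Ici 0)) (hf0 : ∀ t, 0 ≤ t → 0 ≤ f t)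
    (hSc : ContinuousOn S (Ici 0)) (hSm : StrictMonoOn S (Ici 0)) (hS0 : S 0 = 0)
    (hdec : ∀ a b, 0 ≤ a → a ≤ b → (∀ t ∈ Icc a b, B < f t) → S (f b) ≤ S (f a) - α * (b - a))
    {t : ℝ} (ht : S (f 0) / α ≤ t) : f t ≤ B := by
  have hSnn : ∀ x, 0 ≤ x → 0 ≤ S x := fun x hx => by
    rw [← hS0]; exact hSm.monotoneOn self_mem_Ici hx hx
  have ht0 : 0 ≤ t := le_trans (div_nonneg (hSnn _ (hf0 0 le_rfl)) hα.le) ht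
  by_contra! hlt
  by_cases hex : ∃ s ∈ Icc 0 t, f s ≤ B
  · -- After the last time `s` at which `f ≤ B`, the function `S ∘ f` cannot increase.
    have hcomp : IsCompact (Icc 0 t ∩ f ⁻¹' Iic B) := by
      refine isCompact_Icc.of_isClosed_subset ?_ inter_subset_left
      exact (hf.mono Icc_subset_Ici_self).preimage_isClosed_of_isClosed isClosed_Icc isClosed_Iic
    obtain ⟨s, ⟨hs, hsB⟩, hmax⟩ := hcomp.exists_isGreatest (by
      obtain ⟨s, hs, h⟩ := hex
      exact ⟨s, hs, h⟩)
    have hst : s < t := lt_of_le_of_ne hs.2 (by rintro rfl; exact absurd hsB (not_le.2 hlt))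
    have hgt : ∀ r ∈ Ioc s t, B < f r := by
      intro r hr
      by_contra! hle
      exact absurd (hmax ⟨⟨hs.1.trans hr.1.le, hr.2⟩, hle⟩) (not_le.2 hr.1)
    have hle : ∀ r ∈ Ioc s t, S (f t) ≤ S (f r) := by
      intro r hr
      have := hdec r t (hs.1.trans hr.1.le) hr.2
        fun u hu => hgt u ⟨hr.1.trans_le hu.1, hu.2⟩
      nlinarith [mul_nonneg hα.le (sub_nonneg.2 hr.2)]
    have hcont : ContinuousWithinAt (fun r => S (f r)) (Ici 0) s :=
      ContinuousWithinAt.comp (t := Ici 0) (hSc _ (hf0 s hs.1)) (hf s hs.1) hf0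
    have hlim : Tendsto (fun r => S (f r)) (𝓝[>] s) (𝓝 (S (f s))) :=
      hcont.mono fun r hr => hs.1.trans (le_of_lt hr)
    have hfin : S (f t) ≤ S (f s) := by
      refine ge_of_tendsto hlim ?_
      filter_upwards [Ioc_mem_nhdsGT hst] with r hr using hle r hr
    exact absurd ((hSm.le_iff_le (hf0 t ht0) (hf0 s hs.1)).1 hfin)
      (not_le.2 (lt_of_le_of_lt hsB hlt))
  · push Not at hex
    have h1 := hdec 0 t le_rfl ht0 hex
    have h2 : S 0 < S (f t) := hSm self_mem_Ici (hf0 t ht0) (hB.trans_lt hlt)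
    rw [div_le_iff₀ hα] at ht
    rw [hS0] at h2
    nlinarith

/-! ### Scalar inequalities for the Lyapunov function

In this part `ρ`, `w`, `s`, `q`, `e`, `g` stand for `‖z₁‖`, `‖z₁‖ ^ (-θ)`, `‖z₂‖`, `⟪z₁, z₂⟫`, the
energy and its power `e ^ (-γ)`. At `z₁ = 0` the junk value of `w` is `0`, and `w` always comes
multiplied with `ρ` or `q`. -/

theorem weighted_norm_le_energy {α β G w ρ s e : ℝ} (hα : 0 < α) (hβ : 0 < β)
    (he : e = s ^ 2 / 2 + α * (w ^ 2 * ρ ^ 2) + β * ρ ^ 2) :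
    (1 + G ^ 2 * w ^ 2) * ρ ^ 2 + s ^ 2 / 2 ≤ (1 + 1 / β + G ^ 2 / α) * e := by
  have h1 : 0 ≤ α * (w ^ 2 * ρ ^ 2) := by positivity
  have h2 : 0 ≤ β * ρ ^ 2 := by positivity
  have h3 : 0 ≤ s ^ 2 / 2 := by positivity
  have e2 : ρ ^ 2 ≤ 1 / β * e := by
    rw [div_mul_eq_mul_div, le_div_iff₀ hβ]
    linarith
  have e3 : G ^ 2 * w ^ 2 * ρ ^ 2 ≤ G ^ 2 / α * e := by
    rw [div_mul_eq_mul_div, le_div_iff₀ hα]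
    calc G ^ 2 * w ^ 2 * ρ ^ 2 * α = G ^ 2 * (α * (w ^ 2 * ρ ^ 2)) := by ring
      _ ≤ G ^ 2 * e := by gcongr; linarith
  calc (1 + G ^ 2 * w ^ 2) * ρ ^ 2 + s ^ 2 / 2
      = s ^ 2 / 2 + ρ ^ 2 + G ^ 2 * w ^ 2 * ρ ^ 2 := by ring
    _ ≤ e + 1 / β * e + G ^ 2 / α * e := by linarith
    _ = _ := by ring

theorem cross_term_le_energy {G w ρ s q g e C : ℝ} (hρ : 0 ≤ ρ) (hs : 0 ≤ s)
    (hg : 0 ≤ g) (hq : |q| ≤ ρ * s) (hgρ : g * ρ ≤ G * w * ρ)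
    (he : (1 + G ^ 2 * w ^ 2) * ρ ^ 2 + s ^ 2 / 2 ≤ C * e) :
    (1 + g) * |q| ≤ C * e ∧ ((1 + g) * ρ) ^ 2 ≤ 2 * (C * e) := by
  have hhρ : (1 + g) * ρ ≤ (1 + G * w) * ρ := by linarith
  have h0 : 0 ≤ (1 + g) * ρ := by positivity
  have hh2 : ((1 + G * w) * ρ) ^ 2 ≤ 2 * ((1 + G ^ 2 * w ^ 2) * ρ ^ 2) := by
    have : (1 + G * w) ^ 2 ≤ 2 * (1 + G ^ 2 * w ^ 2) := by nlinarith [sq_nonneg (1 - G * w)]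
    calc ((1 + G * w) * ρ) ^ 2 = (1 + G * w) ^ 2 * ρ ^ 2 := by ring
      _ ≤ 2 * (1 + G ^ 2 * w ^ 2) * ρ ^ 2 := by gcongr
      _ = _ := by ring
  constructor
  · calc (1 + g) * |q| ≤ (1 + g) * (ρ * s) := by gcongr
      _ = ((1 + g) * ρ) * s := by ring
      _ ≤ ((1 + G * w) * ρ) * s := by gcongr
      _ ≤ C * e := by nlinarith [sq_nonneg ((1 + G * w) * ρ - s)]
  · calc ((1 + g) * ρ) ^ 2 ≤ ((1 + G * w) * ρ) ^ 2 := by gcongr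
      _ ≤ 2 * (C * e) := by nlinarith [sq_nonneg s]

theorem weighted_norm_le_dissipation {k₁ k₂ k₃ k₄ G w ρ g : ℝ} (hk₁ : 0 < k₁) (hk₂ : 0 < k₂)
    (hk₃ : 0 < k₃) (hk₄ : 0 < k₄) (hG : 0 < G) (hw : 0 ≤ w) (hρ : 0 ≤ ρ)
    (hgρ : g * ρ ≤ G * w * ρ) :
    (1 + g) * ((1 + w ^ 2) * ρ ^ 2) ≤ (1 / k₂ + G / k₁) * (1 / k₃ + 1 / k₄) *
      ((k₃ * w ^ 2 + k₄) * (k₁ * w + k₂) * ρ ^ 2) := by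
  have hhρ : (1 + g) * ρ ≤ (1 + G * w) * ρ := by linarith
  have a1 : 1 + G * w ≤ (1 / k₂ + G / k₁) * (k₁ * w + k₂) := by
    have : (1 / k₂ + G / k₁) * (k₁ * w + k₂) = 1 + G * w + (k₁ * w / k₂ + G * k₂ / k₁) := by
      field_simp; ring
    have : 0 ≤ k₁ * w / k₂ + G * k₂ / k₁ := by positivity
    linarith
  have a2 : 1 + w ^ 2 ≤ (1 / k₃ + 1 / k₄) * (k₃ * w ^ 2 + k₄) := by
    have : (1 / k₃ + 1 / k₄) * (k₃ * w ^ 2 + k₄) = 1 + w ^ 2 + (k₄ / k₃ + k₃ * w ^ 2 / k₄) := by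
      field_simp; ring
    have : 0 ≤ k₄ / k₃ + k₃ * w ^ 2 / k₄ := by positivity
    linarith
  calc (1 + g) * ((1 + w ^ 2) * ρ ^ 2) = ((1 + g) * ρ) * ((1 + w ^ 2) * ρ) := by ring
    _ ≤ ((1 + G * w) * ρ) * ((1 + w ^ 2) * ρ) := by gcongr
    _ = (1 + G * w) * (1 + w ^ 2) * ρ ^ 2 := by ring
    _ ≤ ((1 / k₂ + G / k₁) * (k₁ * w + k₂)) * ((1 / k₃ + 1 / k₄) * (k₃ * w ^ 2 + k₄))
        * ρ ^ 2 := by gcongr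
    _ = _ := by ring

/-- The cross term turns the dissipation `D` of the energy, which does not see `z₂`, into decay of
the whole energy. The indefinite terms it creates are absorbed by `D`, for small `μ`. The remainder
`r` stands for the derivative of the weight `1 + g` of the cross term. -/
theorem nominal_decay {k₁ k₂ k₃ k₄ α β w ρ s q g e D K μ c r : ℝ}
    (hk₁ : 0 < k₁) (hk₂ : 0 < k₂) (hk₃ : 0 < k₃) (hk₄ : 0 < k₄) (hα : 0 < α) (hβ : 0 < β)
    (hμ : 0 < μ) (hc : 0 < c) (hcμ : c ≤ μ) (hcK : c * (α + β) * K ≤ 1 / 4)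
    (hμK : μ * (k₁ ^ 2 + k₂ ^ 2 + k₃ + k₄) * K ≤ 1 / 4)
    (hw : 0 ≤ w) (hg : 0 ≤ g) (hD : 0 ≤ D) (hq : |q| ≤ ρ * s)
    (he : e = s ^ 2 / 2 + α * (w ^ 2 * ρ ^ 2) + β * ρ ^ 2)
    (hhD : (1 + g) * ((1 + w ^ 2) * ρ ^ 2) ≤ K * D) (hr : r ≤ D / 4) :
    -D - μ * (1 + g) * (s ^ 2 - (k₁ * w + k₂) * q - (k₃ * w ^ 2 + k₄) * ρ ^ 2) + r
      ≤ -c * ((1 + g) * e) := by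
  have c1 : (k₁ * w + k₂) * q ≤ (k₁ * w + k₂) * (ρ * s) := by
    gcongr; exact (le_abs_self q).trans hq
  have c2 : (k₁ * w + k₂) ^ 2 ≤ 2 * ((k₁ ^ 2 + k₂ ^ 2) * (1 + w ^ 2)) := by
    nlinarith [sq_nonneg (k₁ * w - k₂), sq_nonneg k₁, sq_nonneg (k₂ * w)]
  have c3 : ((k₁ * w + k₂) * ρ) ^ 2 ≤ 2 * ((k₁ ^ 2 + k₂ ^ 2) * ((1 + w ^ 2) * ρ ^ 2)) := by
    calc ((k₁ * w + k₂) * ρ) ^ 2 = (k₁ * w + k₂) ^ 2 * ρ ^ 2 := by ring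
      _ ≤ 2 * ((k₁ ^ 2 + k₂ ^ 2) * (1 + w ^ 2)) * ρ ^ 2 := by gcongr
      _ = _ := by ring
  have b2 : (k₁ * w + k₂) * q ≤ s ^ 2 / 2 + (k₁ ^ 2 + k₂ ^ 2) * ((1 + w ^ 2) * ρ ^ 2) := by
    linarith [sq_nonneg ((k₁ * w + k₂) * ρ - s)]
  have b3 : (k₃ * w ^ 2 + k₄) * ρ ^ 2 ≤ (k₃ + k₄) * ((1 + w ^ 2) * ρ ^ 2) := by
    linarith [mul_nonneg hk₄.le (sq_nonneg (w * ρ)), mul_nonneg hk₃.le (sq_nonneg ρ)]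
  have b4 : μ * (1 + g) * ((k₁ * w + k₂) * q + (k₃ * w ^ 2 + k₄) * ρ ^ 2)
      ≤ μ * (1 + g) * (s ^ 2 / 2) + D / 4 := by
    calc μ * (1 + g) * ((k₁ * w + k₂) * q + (k₃ * w ^ 2 + k₄) * ρ ^ 2)
        ≤ μ * (1 + g) * (s ^ 2 / 2
            + (k₁ ^ 2 + k₂ ^ 2 + k₃ + k₄) * ((1 + w ^ 2) * ρ ^ 2)) := by
          refine mul_le_mul_of_nonneg_left ?_ (by positivity)
          linarith
      _ = μ * (1 + g) * (s ^ 2 / 2)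
            + μ * (k₁ ^ 2 + k₂ ^ 2 + k₃ + k₄) * ((1 + g) * ((1 + w ^ 2) * ρ ^ 2)) := by ring
      _ ≤ μ * (1 + g) * (s ^ 2 / 2) + μ * (k₁ ^ 2 + k₂ ^ 2 + k₃ + k₄) * (K * D) := by gcongr
      _ = μ * (1 + g) * (s ^ 2 / 2) + μ * (k₁ ^ 2 + k₂ ^ 2 + k₃ + k₄) * K * D := by ring
      _ ≤ μ * (1 + g) * (s ^ 2 / 2) + 1 / 4 * D := by gcongr
      _ = _ := by ring
  have d1 : e ≤ s ^ 2 / 2 + (α + β) * ((1 + w ^ 2) * ρ ^ 2) := by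
    have h1 : 0 ≤ α * ρ ^ 2 := by positivity
    have h2 : 0 ≤ β * (w ^ 2 * ρ ^ 2) := by positivity
    linarith
  have b5 : c * ((1 + g) * e) ≤ μ * (1 + g) * (s ^ 2 / 2) + D / 4 := by
    calc c * ((1 + g) * e)
        ≤ c * ((1 + g) * (s ^ 2 / 2 + (α + β) * ((1 + w ^ 2) * ρ ^ 2))) := by gcongr
      _ = c * (1 + g) * (s ^ 2 / 2)
          + c * (α + β) * ((1 + g) * ((1 + w ^ 2) * ρ ^ 2)) := by ring
      _ ≤ μ * (1 + g) * (s ^ 2 / 2) + c * (α + β) * (K * D) := by gcongr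
      _ = μ * (1 + g) * (s ^ 2 / 2) + c * (α + β) * K * D := by ring
      _ ≤ μ * (1 + g) * (s ^ 2 / 2) + 1 / 4 * D := by gcongr
      _ = _ := by ring
  linarith

theorem disturbance_le {C g ρ s e μ δ v₁ v₂ r : ℝ} (hC : 0 ≤ C) (hg : 0 ≤ g)
    (hμ : 0 < μ) (hμC : μ * (1 + C) ≤ 1 / 4) (hδ : 0 ≤ δ) (he0 : 0 < e)
    (hs : s ^ 2 ≤ 2 * e) (hρ : ((1 + g) * ρ) ^ 2 ≤ 2 * (C * e))
    (hv₁ : |v₁| ≤ ρ * δ) (hv₂ : |v₂| ≤ s * δ) (hr : r ≤ |v₂| / 4) :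
    v₂ - μ * (1 + g) * v₁ + r ≤ 3 * δ * Real.sqrt e := by
  have hsq : Real.sqrt e ^ 2 = e := Real.sq_sqrt he0.le
  have hs0 := Real.sqrt_nonneg e
  have b2 : s ≤ 3 / 2 * Real.sqrt e :=
    abs_le_of_sq_le_sq' (by rw [mul_pow, hsq]; linarith) (by positivity) |>.2
  have b3 : (1 + g) * ρ ≤ 2 * (1 + C) * Real.sqrt e := by
    refine abs_le_of_sq_le_sq' ?_ (by positivity) |>.2
    refine hρ.trans ?_
    rw [mul_pow, hsq]
    nlinarith [mul_nonneg hC he0.le, mul_nonneg (mul_nonneg hC hC) he0.le]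
  have b4 : -(μ * (1 + g) * v₁) ≤ 1 / 2 * (δ * Real.sqrt e) := by
    calc -(μ * (1 + g) * v₁) = μ * ((1 + g) * -v₁) := by ring
      _ ≤ μ * ((1 + g) * (ρ * δ)) := by gcongr; exact (neg_le_abs v₁).trans hv₁
      _ = μ * ((1 + g) * ρ) * δ := by ring
      _ ≤ μ * (2 * (1 + C) * Real.sqrt e) * δ := by gcongr
      _ = 2 * (μ * (1 + C)) * (δ * Real.sqrt e) := by ring
      _ ≤ 2 * (1 / 4) * (δ * Real.sqrt e) := by gcongr
      _ = _ := by ring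
  have b5 : |v₂| ≤ 3 / 2 * (δ * Real.sqrt e) := by
    calc |v₂| ≤ s * δ := hv₂
      _ ≤ 3 / 2 * Real.sqrt e * δ := by gcongr
      _ = _ := by ring
  linarith [le_abs_self v₂, mul_nonneg hδ hs0]

/-- The estimates behind the Lyapunov function `e - μ (1 + g) q`. The four conclusions bound the
cross term, and the parts of the derivative that come from the nominal dynamics, from the drift `z₁`
caused by the growth of the gain, and from a disturbance of size `δ`, where `v₁` and `v₂` are its
inner products with `z₁` and `z₂`. -/
theorem exists_lyapunov_constants {k₁ k₂ k₃ k₄ θ γ G : ℝ} (hk₁ : 0 < k₁) (hk₂ : 0 < k₂)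
    (hk₃ : 0 < k₃) (hk₄ : 0 < k₄) (hθ : 0 < θ) (hθ' : θ < 1 / 2) (hγ : 0 < γ) (hγ' : γ < 1)
    (hG : 0 < G) :
    ∃ μ c : ℝ, 0 < μ ∧ 0 < c ∧ ∀ w ρ s g q e : ℝ, 0 ≤ w → 0 ≤ ρ → 0 ≤ s → 0 ≤ g →
      |q| ≤ ρ * s → g * ρ ≤ G * w * ρ →
      e = s ^ 2 / 2 + k₃ / (2 - 2 * θ) * (w ^ 2 * ρ ^ 2) + k₄ / 2 * ρ ^ 2 → 0 < e →
      μ * (1 + g) * |q| ≤ e / 2 ∧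
      -((k₃ * w ^ 2 + k₄) * (k₁ * w + k₂) * ρ ^ 2)
        - μ * (1 + g) * (s ^ 2 - (k₁ * w + k₂) * q - (k₃ * w ^ 2 + k₄) * ρ ^ 2)
        + μ * γ * (g / e) * -((k₃ * w ^ 2 + k₄) * (k₁ * w + k₂) * ρ ^ 2) * q
        ≤ -c * ((1 + g) * e) ∧
      (k₃ * w ^ 2 + k₄) * ρ ^ 2 - μ * (1 + g) * q
        + μ * γ * (g / e) * ((k₃ * w ^ 2 + k₄) * ρ ^ 2) * q ≤ 3 * e ∧
      ∀ δ v₁ v₂ : ℝ, 0 ≤ δ → |v₁| ≤ ρ * δ → |v₂| ≤ s * δ →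
        v₂ - μ * (1 + g) * v₁ + μ * γ * (g / e) * v₂ * q ≤ 3 * δ * Real.sqrt e := by
  obtain ⟨α, hα⟩ : ∃ x, x = k₃ / (2 - 2 * θ) := ⟨_, rfl⟩
  obtain ⟨β, hβ⟩ : ∃ x, x = k₄ / 2 := ⟨_, rfl⟩
  have hα0 : 0 < α := hα ▸ div_pos hk₃ (by linarith)
  have hβ0 : 0 < β := hβ ▸ half_pos hk₄
  have hαk : k₃ ≤ 2 * α := by
    have : k₃ = (2 - 2 * θ) * α := by
      rw [hα, mul_div_cancel₀]; linarith
    nlinarith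
  obtain ⟨C, hC⟩ : ∃ x, x = 1 + 1 / β + G ^ 2 / α := ⟨_, rfl⟩
  have hC0 : 0 < C := by rw [hC]; positivity
  obtain ⟨K, hK⟩ : ∃ x, x = (1 / k₂ + G / k₁) * (1 / k₃ + 1 / k₄) := ⟨_, rfl⟩
  have hK0 : 0 < K := by rw [hK]; positivity
  obtain ⟨Q, hQ⟩ : ∃ x, x = k₁ ^ 2 + k₂ ^ 2 + k₃ + k₄ := ⟨_, rfl⟩
  have hQ0 : 0 < Q := by rw [hQ]; positivity
  obtain ⟨μ, hμ⟩ : ∃ x, x = 1 / (4 * (1 + C) + 4 * (Q * K)) := ⟨_, rfl⟩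
  have hQK := mul_pos hQ0 hK0
  have hμ0 : 0 < μ := by rw [hμ]; positivity
  have hμC : μ * (1 + C) ≤ 1 / 4 := by
    rw [hμ, div_mul_eq_mul_div, one_mul, div_le_iff₀ (by positivity)]
    linarith
  have hμK : μ * Q * K ≤ 1 / 4 := by
    rw [hμ, mul_assoc, div_mul_eq_mul_div, one_mul, div_le_iff₀ (by positivity)]
    linarith
  obtain ⟨c, hc⟩ : ∃ x, x = min μ (1 / (4 * ((α + β) * K))) := ⟨_, rfl⟩
  have hc0 : 0 < c := hc ▸ lt_min hμ0 (by positivity)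
  have hcμ : c ≤ μ := hc ▸ min_le_left _ _
  have hcK : c * (α + β) * K ≤ 1 / 4 := by
    have : c ≤ 1 / (4 * ((α + β) * K)) := hc ▸ min_le_right _ _
    rw [le_div_iff₀ (by positivity)] at this
    linarith
  refine ⟨μ, c, hμ0, hc0, ?_⟩
  intro w ρ s g q e hw hρ hs hg hq hgρ he he0
  rw [← hα, ← hβ] at he
  have h1 : 0 ≤ α * (w ^ 2 * ρ ^ 2) := by positivity
  have h2 : 0 ≤ β * ρ ^ 2 := by positivity
  have h3 : 0 ≤ s ^ 2 / 2 := by positivity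
  obtain ⟨hhq, hhρ⟩ := cross_term_le_energy hρ hs hg hq hgρ
    (hC ▸ weighted_norm_le_energy (G := G) hα0 hβ0 he)
  have hμq : μ * (1 + g) * |q| ≤ e / 4 := by
    calc μ * (1 + g) * |q| = μ * ((1 + g) * |q|) := by ring
      _ ≤ μ * (C * e) := by gcongr
      _ ≤ μ * ((1 + C) * e) := by gcongr; linarith
      _ = μ * (1 + C) * e := by ring
      _ ≤ 1 / 4 * e := by gcongr
      _ = e / 4 := by ring
  have hμg : ∀ x, μ * γ * (g / e) * x * q ≤ |x| / 4 := by
    intro x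
    have h4 : μ * g * |q| ≤ e / 4 := by
      refine le_trans ?_ hμq
      gcongr; linarith
    calc μ * γ * (g / e) * x * q ≤ |μ * γ * (g / e) * x * q| := le_abs_self _
      _ = γ * ((μ * g * |q|) / e) * |x| := by
        rw [abs_mul, abs_mul, abs_of_nonneg (by positivity : 0 ≤ μ * γ * (g / e))]; ring
      _ ≤ 1 * ((e / 4) / e) * |x| := by gcongr
      _ = |x| / 4 := by field_simp
  have hD0 : 0 ≤ (k₃ * w ^ 2 + k₄) * (k₁ * w + k₂) * ρ ^ 2 := by positivity
  have hP0 : 0 ≤ (k₃ * w ^ 2 + k₄) * ρ ^ 2 := by positivity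
  refine ⟨by linarith, ?_, ?_, ?_⟩
  · refine nominal_decay hk₁ hk₂ hk₃ hk₄ hα0 hβ0 hμ0 hc0 hcμ hcK (hQ ▸ hμK) hw hg hD0 hq he
      (hK ▸ weighted_norm_le_dissipation hk₁ hk₂ hk₃ hk₄ hG hw hρ hgρ) ?_
    refine (hμg _).trans_eq ?_
    rw [abs_neg, abs_of_nonneg hD0]
  · have hPe : (k₃ * w ^ 2 + k₄) * ρ ^ 2 ≤ 2 * e := by
      have : 0 ≤ (2 * α - k₃) * (w ^ 2 * ρ ^ 2) := mul_nonneg (by linarith) (by positivity)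
      have : k₄ = 2 * β := by rw [hβ]; ring
      rw [this]
      linarith
    have b1 := hμg ((k₃ * w ^ 2 + k₄) * ρ ^ 2)
    rw [abs_of_nonneg hP0] at b1
    have b2 : -(μ * (1 + g) * q) ≤ μ * (1 + g) * |q| := by
      rw [← mul_neg]
      gcongr; exact neg_le_abs q
    linarith
  · intro δ v₁ v₂ hδ hv₁ hv₂
    exact disturbance_le hC0.le hg hμ0 hμC hδ he0 (by linarith) hhρ hv₁ hv₂ (hμg v₂)

/-! ### The Lyapunov function -/

theorem rpow_two_sub_two_mul {θ ρ : ℝ} (hθ' : θ < 1) (hρ : 0 ≤ ρ) :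
    ρ ^ (2 - 2 * θ) = (ρ ^ (-θ)) ^ 2 * ρ ^ 2 := by
  rcases hρ.eq_or_lt with rfl | hρ
  · rw [Real.zero_rpow (by linarith)]; simp
  · rw [← Real.rpow_natCast, ← Real.rpow_mul hρ.le, ← Real.rpow_natCast ρ, ← Real.rpow_add hρ]
    congr 1; push_cast; ring

theorem rpow_neg_mul_le {θ γ α ρ e : ℝ} (hθ : 0 < θ) (hθ' : θ < 1) (hγ : γ = θ / (2 - 2 * θ))
    (hα : 0 < α) (hρ : 0 ≤ ρ) (he : α * ρ ^ (2 - 2 * θ) ≤ e) :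
    e ^ (-γ) * ρ ≤ α ^ (-γ) * ρ ^ (-θ) * ρ := by
  rcases hρ.eq_or_lt with rfl | hρ
  · simp
  have hγ0 : 0 ≤ γ := by rw [hγ]; exact div_nonneg hθ.le (by linarith)
  gcongr
  calc e ^ (-γ) ≤ (α * ρ ^ (2 - 2 * θ)) ^ (-γ) :=
        Real.rpow_le_rpow_of_nonpos (by positivity) he (by linarith)
    _ = α ^ (-γ) * ρ ^ (-θ) := by
        rw [Real.mul_rpow hα.le (by positivity), ← Real.rpow_mul hρ.le]
        congr 2
        rw [hγ, mul_neg, mul_div_cancel₀]; linarith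

section Energy

variable {F : Type*} [NormedAddCommGroup F]

/-- The energy of the unperturbed system in the rescaled coordinates `z₁ = L₀ x₁`, `z₂ = x₂`:
kinetic part `‖z₂‖² / 2` plus the potential of the force `(k₃ ‖z₁‖ ^ (-2θ) + k₄) z₁`. -/
noncomputable def energy (θ k₃ k₄ : ℝ) (z₁ z₂ : F) : ℝ :=
  ‖z₂‖ ^ 2 / 2 + k₃ / (2 - 2 * θ) * ‖z₁‖ ^ (2 - 2 * θ) + k₄ / 2 * ‖z₁‖ ^ 2

theorem energy_nonneg {θ k₃ k₄ : ℝ} (hk₃ : 0 < k₃) (hk₄ : 0 < k₄) (hθ : θ < 1) (z₁ z₂ : F) :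
    0 ≤ energy θ k₃ k₄ z₁ z₂ := by
  have : 0 < k₃ / (2 - 2 * θ) := div_pos hk₃ (by linarith)
  unfold energy
  positivity

theorem sq_norm_le_energy {θ k₃ k₄ : ℝ} (hk₃ : 0 < k₃) (hk₄ : 0 < k₄) (hθ : θ < 1) (z₁ z₂ : F) :
    k₄ / 2 * ‖z₁‖ ^ 2 ≤ energy θ k₃ k₄ z₁ z₂ ∧ ‖z₂‖ ^ 2 / 2 ≤ energy θ k₃ k₄ z₁ z₂ := by
  have : 0 < k₃ / (2 - 2 * θ) := div_pos hk₃ (by linarith)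
  have h1 : 0 ≤ k₃ / (2 - 2 * θ) * ‖z₁‖ ^ (2 - 2 * θ) := by positivity
  have h2 : 0 ≤ k₄ / 2 * ‖z₁‖ ^ 2 := by positivity
  have h3 : 0 ≤ ‖z₂‖ ^ 2 / 2 := by positivity
  unfold energy
  constructor <;> linarith

theorem continuous_energy {θ k₃ k₄ : ℝ} (hθ' : θ < 1 / 2) :
    Continuous (fun y : F × F => energy θ k₃ k₄ y.1 y.2) := by
  unfold energy
  fun_prop (disch := simp; linarith)

end Energy

section Lyapunov

variable {F : Type*} [NormedAddCommGroup F] [InnerProductSpace ℝ F]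

/-- The energy, corrected by a cross term that has the same homogeneity as the energy both near the
origin and at infinity when `γ = θ / (2 - 2θ)`. -/
noncomputable def lyapunov (θ k₃ k₄ γ μ : ℝ) (z₁ z₂ : F) : ℝ :=
  energy θ k₃ k₄ z₁ z₂ - μ * (1 + energy θ k₃ k₄ z₁ z₂ ^ (-γ)) * inner ℝ z₁ z₂

/-- The derivative of the energy at `(z₁, z₂)` in the direction `(u₁, u₂)`. -/
noncomputable def energyDeriv (θ k₃ k₄ : ℝ) (z₁ z₂ u₁ u₂ : F) : ℝ :=
  inner ℝ z₂ u₂ + (k₃ * (‖z₁‖ ^ (-θ)) ^ 2 + k₄) * inner ℝ z₁ u₁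

/-- The derivative of the Lyapunov function at `(z₁, z₂)` in the direction `(u₁, u₂)`, at points of
positive energy. -/
noncomputable def lyapunovDeriv (θ k₃ k₄ γ μ : ℝ) (z₁ z₂ u₁ u₂ : F) : ℝ :=
  energyDeriv θ k₃ k₄ z₁ z₂ u₁ u₂
    - μ * (1 + energy θ k₃ k₄ z₁ z₂ ^ (-γ)) * (inner ℝ z₁ u₂ + inner ℝ u₁ z₂)
    + μ * γ * (energy θ k₃ k₄ z₁ z₂ ^ (-γ) / energy θ k₃ k₄ z₁ z₂)
      * energyDeriv θ k₃ k₄ z₁ z₂ u₁ u₂ * inner ℝ z₁ z₂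

theorem hasDerivAt_energy {θ k₃ k₄ : ℝ} (hθ : 0 < θ) (hθ' : θ < 1 / 2) {z₁ z₂ : ℝ → F} {u₁ u₂ : F}
    {t : ℝ} (h₁ : HasDerivAt z₁ u₁ t) (h₂ : HasDerivAt z₂ u₂ t) :
    HasDerivAt (fun s => energy θ k₃ k₄ (z₁ s) (z₂ s))
      (energyDeriv θ k₃ k₄ (z₁ t) (z₂ t) u₁ u₂) t := by
  have hpow : HasDerivAt (fun s => ‖z₁ s‖ ^ (2 - 2 * θ))
      ((2 - 2 * θ) * (‖z₁ t‖ ^ (-θ)) ^ 2 * inner ℝ (z₁ t) u₁) t := by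
    have := (hasFDerivAt_norm_rpow (z₁ t) (p := 2 - 2 * θ) (by linarith)).comp_hasDerivAt t h₁
    convert! this using 1
    have : ‖z₁ t‖ ^ (2 - 2 * θ - 2) = (‖z₁ t‖ ^ (-θ)) ^ 2 := by
      rw [← Real.rpow_natCast, ← Real.rpow_mul (norm_nonneg _)]
      congr 1; push_cast; ring
    simp only [_root_.smul_apply, smul_eq_mul, this, innerSL_apply_apply]
  unfold energy energyDeriv
  refine (((h₂.norm_sq.div_const 2).add (hpow.const_mul (k₃ / (2 - 2 * θ)))).add
    (h₁.norm_sq.const_mul (k₄ / 2))).congr_deriv ?_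
  have : k₃ / (2 - 2 * θ) * (2 - 2 * θ) = k₃ := div_mul_cancel₀ _ (by linarith)
  linear_combination ((‖z₁ t‖ ^ (-θ)) ^ 2 * inner ℝ (z₁ t) u₁) * this

theorem hasDerivAt_lyapunov {θ k₃ k₄ γ μ : ℝ} (hθ : 0 < θ) (hθ' : θ < 1 / 2) {z₁ z₂ : ℝ → F}
    {u₁ u₂ : F} {t : ℝ} (h₁ : HasDerivAt z₁ u₁ t) (h₂ : HasDerivAt z₂ u₂ t)
    (hpos : 0 < energy θ k₃ k₄ (z₁ t) (z₂ t)) :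
    HasDerivAt (fun s => lyapunov θ k₃ k₄ γ μ (z₁ s) (z₂ s))
      (lyapunovDeriv θ k₃ k₄ γ μ (z₁ t) (z₂ t) u₁ u₂) t := by
  have hE := hasDerivAt_energy (k₃ := k₃) (k₄ := k₄) hθ hθ' h₁ h₂
  have hp := hE.rpow_const (p := -γ) (Or.inl hpos.ne')
  unfold lyapunov lyapunovDeriv
  refine (hE.fun_sub (((hp.const_add 1).const_mul μ).fun_mul (h₁.inner ℝ h₂))).congr_deriv ?_
  rw [Real.rpow_sub_one hpos.ne']
  ring

theorem contDiffAt_lyapunov {θ k₃ k₄ γ μ : ℝ} (hθ' : θ < 1 / 2) {y : F × F}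
    (hpos : 0 < energy θ k₃ k₄ y.1 y.2) :
    ContDiffAt ℝ 1 (fun y : F × F => lyapunov θ k₃ k₄ γ μ y.1 y.2) y := by
  have hE : ContDiff ℝ 1 (fun y : F × F => energy θ k₃ k₄ y.1 y.2) := by
    unfold energy
    exact (((contDiff_snd.norm_sq ℝ).div_const 2).add
      (contDiff_const.mul (contDiff_fst.norm_rpow (by linarith)))).add
      (contDiff_const.mul (contDiff_fst.norm_sq ℝ))
  unfold lyapunov
  exact hE.contDiffAt.sub ((contDiffAt_const.mul
    (contDiffAt_const.add (hE.contDiffAt.rpow_const_of_ne hpos.ne'))).mul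
    (contDiff_fst.inner ℝ contDiff_snd).contDiffAt)

theorem continuous_lyapunov {θ k₃ k₄ γ μ : ℝ} (hk₃ : 0 < k₃) (hk₄ : 0 < k₄) (hθ' : θ < 1 / 2)
    (hle : ∀ z₁ z₂ : F, 0 ≤ lyapunov θ k₃ k₄ γ μ z₁ z₂ ∧
      lyapunov θ k₃ k₄ γ μ z₁ z₂ ≤ 2 * energy θ k₃ k₄ z₁ z₂) :
    Continuous (fun y : F × F => lyapunov θ k₃ k₄ γ μ y.1 y.2) := by
  rw [continuous_iff_continuousAt]
  intro y
  rcases (energy_nonneg hk₃ hk₄ (by linarith) y.1 y.2).eq_or_lt with h0 | hpos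
  · have hE : ContinuousAt (fun y : F × F => 2 * energy θ k₃ k₄ y.1 y.2) y :=
      ((continuous_energy hθ').const_mul 2).continuousAt
    have hl0 : lyapunov θ k₃ k₄ γ μ y.1 y.2 = 0 :=
      le_antisymm ((hle _ _).2.trans (by rw [← h0]; simp)) (hle _ _).1
    rw [ContinuousAt, ← h0, mul_zero] at hE
    rw [ContinuousAt, hl0]
    exact squeeze_zero (fun y => (hle _ _).1) (fun y => (hle _ _).2) hE
  · exact (contDiffAt_lyapunov hθ' hpos).continuousAt

/-- Comparability of the Lyapunov function with the energy, and its decay in the direction of the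
rescaled vector field. Here `L` is the gain, which only sets the time scale of the nominal part,
`l` is its logarithmic derivative, and `d` is the disturbance. -/
theorem exists_lyapunov_decay (F : Type*) [NormedAddCommGroup F] [InnerProductSpace ℝ F]
    {k₁ k₂ k₃ k₄ θ γ : ℝ} (hk₁ : 0 < k₁) (hk₂ : 0 < k₂) (hk₃ : 0 < k₃) (hk₄ : 0 < k₄)
    (hθ : 0 < θ) (hθ' : θ < 1 / 2) (hγ : γ = θ / (2 - 2 * θ)) :
    ∃ μ c : ℝ, 0 < c ∧
      (∀ z₁ z₂ : F, energy θ k₃ k₄ z₁ z₂ ≤ 2 * lyapunov θ k₃ k₄ γ μ z₁ z₂ ∧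
        lyapunov θ k₃ k₄ γ μ z₁ z₂ ≤ 2 * energy θ k₃ k₄ z₁ z₂) ∧
      ∀ (z₁ z₂ d : F) (L l δ : ℝ), 0 < energy θ k₃ k₄ z₁ z₂ → 0 ≤ L → 0 ≤ l → ‖d‖ ≤ δ →
        lyapunovDeriv θ k₃ k₄ γ μ z₁ z₂
          (L • (z₂ - (k₁ * ‖z₁‖ ^ (-θ) + k₂) • z₁) + l • z₁)
          (d - (L * (k₃ * (‖z₁‖ ^ (-θ)) ^ 2 + k₄)) • z₁) ≤
        -c * L * ((1 + energy θ k₃ k₄ z₁ z₂ ^ (-γ)) * energy θ k₃ k₄ z₁ z₂)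
          + l * (3 * energy θ k₃ k₄ z₁ z₂) + 3 * δ * Real.sqrt (energy θ k₃ k₄ z₁ z₂) := by
  have hden : 0 < 2 - 2 * θ := by linarith
  have hγ0 : 0 < γ := by rw [hγ]; exact div_pos hθ hden
  have hγ1 : γ < 1 := by rw [hγ, div_lt_one hden]; linarith
  have hα : 0 < k₃ / (2 - 2 * θ) := div_pos hk₃ hden
  obtain ⟨μ, c, hμ, hc, H⟩ := exists_lyapunov_constants hk₁ hk₂ hk₃ hk₄ hθ hθ' hγ0 hγ1
    (Real.rpow_pos_of_pos hα (-γ))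
  have Hz : ∀ z₁ z₂ : F, 0 < energy θ k₃ k₄ z₁ z₂ → _ := fun z₁ z₂ hpos =>
    H (‖z₁‖ ^ (-θ)) ‖z₁‖ ‖z₂‖ (energy θ k₃ k₄ z₁ z₂ ^ (-γ)) (inner ℝ z₁ z₂)
      (energy θ k₃ k₄ z₁ z₂) (by positivity) (by positivity) (by positivity) (by positivity)
      (abs_real_inner_le_norm z₁ z₂)
      (rpow_neg_mul_le hθ (by linarith) hγ hα (norm_nonneg _) (by
        have : 0 ≤ k₄ / 2 * ‖z₁‖ ^ 2 := by positivity
        have : 0 ≤ ‖z₂‖ ^ 2 / 2 := by positivity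
        unfold energy; linarith))
      (by rw [energy, rpow_two_sub_two_mul (by linarith) (norm_nonneg _)])
      hpos
  refine ⟨μ, c, hc, ?_, ?_⟩
  · intro z₁ z₂
    rcases (energy_nonneg hk₃ hk₄ (by linarith : θ < 1) z₁ z₂).eq_or_lt with h0 | hpos
    · have hz := (sq_norm_le_energy hk₃ hk₄ (by linarith : θ < 1) z₁ z₂).2
      have : z₂ = 0 := by
        rw [← h0] at hz
        have : ‖z₂‖ ^ 2 = 0 := le_antisymm (by linarith) (by positivity)
        simpa using this
      unfold lyapunov
      rw [← h0, this]; simp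
    · have h1 := (Hz z₁ z₂ hpos).1
      have h2 : |μ * (1 + energy θ k₃ k₄ z₁ z₂ ^ (-γ)) * inner ℝ z₁ z₂|
          ≤ energy θ k₃ k₄ z₁ z₂ / 2 := by
        rwa [abs_mul, abs_of_nonneg (by positivity)]
      obtain ⟨h3, h4⟩ := abs_le.1 h2
      unfold lyapunov
      constructor <;> linarith
  · intro z₁ z₂ d L l δ hpos hL hl hd
    obtain ⟨-, h1, h2, h3⟩ := Hz z₁ z₂ hpos
    have h3 := h3 δ (inner ℝ z₁ d) (inner ℝ z₂ d) ((norm_nonneg d).trans hd)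
      ((abs_real_inner_le_norm z₁ d).trans (by gcongr))
      ((abs_real_inner_le_norm z₂ d).trans (by gcongr))
    have h1 := mul_le_mul_of_nonneg_left h1 hL
    have h2 := mul_le_mul_of_nonneg_left h2 hl
    refine le_trans (le_of_eq ?_) (add_le_add (add_le_add h1 h2) h3) |>.trans_eq (by ring)
    simp only [lyapunovDeriv, energyDeriv, inner_add_right, inner_add_left, inner_sub_right,
      inner_sub_left, inner_smul_left, inner_smul_right, real_inner_self_eq_norm_sq,
      real_inner_comm z₁ z₂, RCLike.conj_to_real]
    ring

end Lyapunov

/-! ### Decay of the weighted Lyapunov function -/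

/-- The weight `exp (A / L)` turns the growth `6 (v / L) V` caused by the drift of the gain into
decay as long as `L ≤ A / 6`; for larger `L` the nominal decay, of rate `c L`, is stronger. -/
theorem drift_le {A c κ L v : ℝ} (hA : 0 < A) (hc : 0 < c)
    (hAc : 864 * κ ≤ A ^ 2 * c) (hL : 0 < L) (hv : 0 ≤ v) (hv' : v ≤ κ) :
    6 * (v / L) - A * v / L ^ 2 ≤ c / 4 * L := by
  have key : 6 * v * L - A * v ≤ c / 4 * L ^ 3 := by
    rcases le_or_gt (6 * L) A with h | h
    · have h1 : 0 ≤ v * (A - 6 * L) := mul_nonneg hv (by linarith)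
      have : 0 ≤ c / 4 * L ^ 3 := by positivity
      linarith
    · have h1 : A ^ 2 * c ≤ (6 * L) ^ 2 * c := by gcongr
      have h2 : 6 * v ≤ c / 4 * L ^ 2 := by linarith
      have h3 : 6 * v * L ≤ c / 4 * L ^ 2 * L := by gcongr
      have : 0 ≤ A * v := by positivity
      linarith
  have : 6 * (v / L) - A * v / L ^ 2 = (6 * v * L - A * v) / L ^ 2 := by
    field_simp
  rw [this, div_le_iff₀ (by positivity)]
  linarith

/-- The differential inequality for the weighted function `W = exp (A / L) V`, given the bound on
the derivative `D` of `V` in terms of the energy `e`. -/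
theorem weighted_decay {A c κ ℓ L v δ γ e V D : ℝ} (hA : 0 < A) (hc : 0 < c)
    (hAc : 864 * κ ≤ A ^ 2 * c) (hℓ : 0 < ℓ) (hL : ℓ ≤ L) (hv : 0 ≤ v) (hv' : v ≤ κ) (hδ : 0 ≤ δ)
    (hγ : 0 < γ) (hγ' : γ < 1) (he : 0 < e) (heV : e ≤ 2 * V) (hVe : V ≤ 2 * e)
    (hD : D ≤ -c * L * ((1 + e ^ (-γ)) * e) + v / L * (3 * e) + 3 * δ * Real.sqrt e)
    (hB : (40 * δ * Real.exp (A / ℓ) / (c * ℓ)) ^ 2 < Real.exp (A / L) * V) :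
    Real.exp (A / L) * (D - A * v / L ^ 2 * V) ≤
      -(c * ℓ / 8) * (Real.exp (A / L) * V + (Real.exp (A / L) * V) ^ (1 - γ)) := by
  have hL0 : 0 < L := hℓ.trans_le hL
  have hV : 0 < V := by linarith
  obtain ⟨x, hx⟩ : ∃ x, x = Real.exp (A / L) := ⟨_, rfl⟩
  obtain ⟨M, hM⟩ : ∃ x, x = Real.exp (A / ℓ) := ⟨_, rfl⟩
  rw [← hx]
  rw [← hx, ← hM] at hB
  have hx1 : 1 ≤ x := by rw [hx]; exact Real.one_le_exp (by positivity)
  have hxM : x ≤ M := by rw [hx, hM]; gcongr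
  have hM0 : 0 < M := by linarith
  have hVp : 0 ≤ V ^ (1 - γ) := by positivity
  -- `D - (A v / L²) V ≤ -(c ℓ / 4) (V + V ^ (1 - γ)) + 5 δ √V`
  have h1 : (V + V ^ (1 - γ)) / 2 ≤ (1 + e ^ (-γ)) * e := by
    have e1 : (1 + e ^ (-γ)) * e = e + e ^ (1 - γ) := by
      rw [sub_eq_neg_add, Real.rpow_add_one he.ne']; ring
    have e2 : V ^ (1 - γ) ≤ 2 * e ^ (1 - γ) := by
      calc V ^ (1 - γ) ≤ (2 * e) ^ (1 - γ) := by gcongr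
        _ = 2 ^ (1 - γ) * e ^ (1 - γ) := Real.mul_rpow (by norm_num) he.le
        _ ≤ 2 ^ (1 : ℝ) * e ^ (1 - γ) := by gcongr <;> linarith
        _ = _ := by rw [Real.rpow_one]
    rw [e1]; linarith
  have h2 : 3 * Real.sqrt e ≤ 5 * Real.sqrt V := by
    have : Real.sqrt e ≤ 5 / 3 * Real.sqrt V := by
      refine Real.sqrt_le_iff.2 ⟨by positivity, ?_⟩
      rw [mul_pow, Real.sq_sqrt hV.le]
      linarith
    linarith
  have h3 : D - A * v / L ^ 2 * V ≤ -(c * ℓ / 4) * (V + V ^ (1 - γ)) + 5 * δ * Real.sqrt V := by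
    have hdr := mul_le_mul_of_nonneg_right (drift_le hA hc hAc hL0 hv hv') hV.le
    have a1 : c * L * ((V + V ^ (1 - γ)) / 2) ≤ c * L * ((1 + e ^ (-γ)) * e) := by gcongr
    have a2 : v / L * (3 * e) ≤ v / L * (6 * V) :=
      mul_le_mul_of_nonneg_left (by linarith) (by positivity)
    have a3 : δ * (3 * Real.sqrt e) ≤ δ * (5 * Real.sqrt V) := by gcongr
    have a4 : c * ℓ / 4 * (V + V ^ (1 - γ)) ≤ c * L / 4 * (V + V ^ (1 - γ)) := by gcongr
    have a5 : 0 ≤ c * L * V ^ (1 - γ) := by positivity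
    linarith
  have hW0 : 0 < x * V := by positivity
  have h4 : (x * V) ^ (1 - γ) ≤ x * V ^ (1 - γ) := by
    rw [Real.mul_rpow (by linarith) hV.le]
    gcongr
    exact Real.rpow_le_self_of_one_le hx1 (by linarith)
  have h5 : 5 * δ * (x * Real.sqrt V) ≤ c * ℓ / 8 * (x * V) := by
    have b1 : Real.sqrt V ≤ Real.sqrt (x * V) := Real.sqrt_le_sqrt (by nlinarith)
    have b2 : 40 * δ * M / (c * ℓ) ≤ Real.sqrt (x * V) := Real.le_sqrt_of_sq_le hB.le
    rw [div_le_iff₀ (by positivity)] at b2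
    calc 5 * δ * (x * Real.sqrt V) ≤ 5 * δ * (M * Real.sqrt (x * V)) := by gcongr
      _ = 40 * δ * M / 8 * Real.sqrt (x * V) := by ring
      _ ≤ Real.sqrt (x * V) * (c * ℓ) / 8 * Real.sqrt (x * V) := by gcongr
      _ = c * ℓ / 8 * (Real.sqrt (x * V) * Real.sqrt (x * V)) := by ring
      _ = _ := by rw [Real.mul_self_sqrt hW0.le]
  calc x * (D - A * v / L ^ 2 * V)
      ≤ x * (-(c * ℓ / 4) * (V + V ^ (1 - γ)) + 5 * δ * Real.sqrt V) := by gcongr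
    _ = -(c * ℓ / 4) * (x * V) - c * ℓ / 4 * (x * V ^ (1 - γ)) + 5 * δ * (x * Real.sqrt V) := by
      ring
    _ ≤ -(c * ℓ / 4) * (x * V) - c * ℓ / 4 * (x * V) ^ (1 - γ) + c * ℓ / 8 * (x * V) := by
      gcongr
    _ ≤ _ := by
      have : 0 ≤ c * ℓ / 8 * (x * V) ^ (1 - γ) := by positivity
      linarith

/-- The time to go `log (1 + W ^ γ)` of `W' = -(W + W ^ (1 - γ))`, up to the factor `γ`. -/
noncomputable def timeToGo (γ w : ℝ) : ℝ := Real.log (1 + w ^ γ)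

theorem continuousOn_timeToGo {γ : ℝ} (hγ : 0 < γ) : ContinuousOn (timeToGo γ) (Ici 0) := by
  intro w hw
  have hw : 0 ≤ w := hw
  have : 1 + w ^ γ ≠ 0 := by positivity
  unfold timeToGo
  exact ((continuousAt_const.add (Real.continuousAt_rpow_const _ _ (Or.inr hγ.le))).log
    this).continuousWithinAt

theorem strictMonoOn_timeToGo {γ : ℝ} (hγ : 0 < γ) : StrictMonoOn (timeToGo γ) (Ici 0) := by
  intro x hx y hy hxy
  have hx : 0 ≤ x := hx
  exact Real.log_lt_log (by positivity) (by gcongr)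

theorem timeToGo_zero {γ : ℝ} (hγ : 0 < γ) : timeToGo γ 0 = 0 := by
  simp [timeToGo, Real.zero_rpow hγ.ne']

theorem hasDerivAt_timeToGo {γ : ℝ} {W : ℝ → ℝ} {t W' a : ℝ} (hγ : 0 < γ)
    (hW : HasDerivAt W W' t) (hpos : 0 < W t) (hle : W' ≤ -a * (W t + W t ^ (1 - γ))) :
    ∃ v ≤ -(a * γ), HasDerivAt (fun s => timeToGo γ (W s)) v t := by
  have hp : 0 < W t ^ γ := by positivity
  have hp' : 0 < W t ^ (γ - 1) := by positivity
  refine ⟨_, ?_, ((hW.rpow_const (p := γ) (Or.inl hpos.ne')).const_add 1).log (by positivity)⟩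
  rw [div_le_iff₀ (by positivity)]
  have e1 : W t ^ (γ - 1) * W t = W t ^ γ := by
    rw [← Real.rpow_add_one hpos.ne']; congr 1; ring
  have e2 : W t ^ (γ - 1) * W t ^ (1 - γ) = 1 := by
    rw [← Real.rpow_add hpos]; simp
  calc W' * γ * W t ^ (γ - 1) ≤ -a * (W t + W t ^ (1 - γ)) * γ * W t ^ (γ - 1) := by gcongr
    _ = -(a * γ) * (W t ^ (γ - 1) * W t ^ (1 - γ) + W t ^ (γ - 1) * W t) := by ring
    _ = _ := by rw [e1, e2]

/-! ### The closed loop in rescaled coordinates -/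

theorem gain1_mul_inv_rpow {F : Type*} [NormedAddCommGroup F] [NormedSpace ℝ F] {m k₁ L : ℝ}
    (hm : 2 < m) (hL : 0 < L) (x : F) :
    gain1 m k₁ L * (‖x‖ ^ (1 / m))⁻¹ = k₁ * ‖L • x‖ ^ (-(1 / m)) * L := by
  have h1 : (m - 1) / m = -(1 / m) + 1 := by
    have : m ≠ 0 := by linarith
    field_simp; ring
  rw [gain1, norm_smul, Real.norm_of_nonneg hL.le, Real.mul_rpow hL.le (norm_nonneg x),
    Real.rpow_neg (norm_nonneg x), h1, Real.rpow_add_one hL.ne']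
  ring

theorem gain3_mul_inv_rpow {F : Type*} [NormedAddCommGroup F] [NormedSpace ℝ F] {m k₃ L : ℝ}
    (hm : 2 < m) (hL : 0 < L) (x : F) :
    gain3 m k₃ L * (‖x‖ ^ (2 / m))⁻¹ = L * (k₃ * (‖L • x‖ ^ (-(1 / m))) ^ 2) * L := by
  have h1 : (2 * m - 2) / m = -(1 / m) + -(1 / m) + 1 + 1 := by
    have : m ≠ 0 := by linarith
    field_simp; ring
  have h2 : ‖x‖ ^ (2 / m) = (‖x‖ ^ (1 / m)) ^ 2 := by
    rw [← Real.rpow_natCast, ← Real.rpow_mul (norm_nonneg x)]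
    congr 1; push_cast; ring
  rw [gain3, norm_smul, Real.norm_of_nonneg hL.le, Real.mul_rpow hL.le (norm_nonneg x),
    Real.rpow_neg (norm_nonneg x), h1, h2, Real.rpow_add_one hL.ne', Real.rpow_add_one hL.ne',
    Real.rpow_add hL]
  ring

theorem rescaled_field_fst {F : Type*} [NormedAddCommGroup F] [NormedSpace ℝ F] {m k₁ k₂ L v : ℝ}
    (hm : 2 < m) (hL : 0 < L) (x₁ x₂ : F) :
    L • (-(gain1 m k₁ L • (‖x₁‖ ^ (1 / m))⁻¹ • x₁) - gain2 k₂ L • x₁ + x₂) + v • x₁ =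
      L • (x₂ - (k₁ * ‖L • x₁‖ ^ (-(1 / m)) + k₂) • (L • x₁)) + (v / L) • (L • x₁) := by
  rw [smul_smul (gain1 m k₁ L), gain1_mul_inv_rpow hm hL, smul_smul (v / L),
    div_mul_cancel₀ _ hL.ne', gain2]
  module

theorem rescaled_field_snd {F : Type*} [NormedAddCommGroup F] [NormedSpace ℝ F] {m k₃ k₄ L : ℝ}
    (hm : 2 < m) (hL : 0 < L) (x₁ d : F) :
    -(gain3 m k₃ L • (‖x₁‖ ^ (2 / m))⁻¹ • x₁) - gain4 k₄ L • x₁ + d =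
      d - (L * (k₃ * (‖L • x₁‖ ^ (-(1 / m))) ^ 2 + k₄)) • (L • x₁) := by
  rw [smul_smul (gain3 m k₃ L), gain3_mul_inv_rpow hm hL, gain4]
  module

/-! ### Solutions -/

theorem continuousOn_Ici_of_absolutelyContinuous {X : Type*} [SeminormedAddCommGroup X]
    {f : ℝ → X}
    (hf : ∀ T : ℝ, 0 ≤ T → AbsolutelyContinuousOnInterval f 0 T) : ContinuousOn f (Ici 0) := by
  intro t ht
  have ht : 0 ≤ t := ht
  have h := (hf (t + 1) (by linarith)).continuousOn
  rw [uIcc_of_le (by linarith : (0 : ℝ) ≤ t + 1)] at h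
  refine (h t ⟨ht, by linarith⟩).mono_of_mem_nhdsWithin ?_
  filter_upwards [inter_mem_nhdsWithin (Ici 0) (Iio_mem_nhds (lt_add_one t))] with s hs
  exact ⟨hs.1, le_of_lt hs.2⟩

section Solutions

variable {n : ℕ} {m k₁ k₂ k₃ k₄ κ ε : ℝ} {d x₁ x₂ : ℝ → EuclideanSpace ℝ (Fin n)} {L₀ : ℝ → ℝ}

theorem IsAdaptiveSolution.le_gain (h : IsAdaptiveSolution m k₁ k₂ k₃ k₄ κ ε d x₁ x₂ L₀) {t : ℝ}
    (ht : 0 ≤ t) : L₀ 0 ≤ L₀ t := by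
  have := (h.ac_L₀ t ht).fun_neg.sub_le_mul_of_ae_hasDerivAt_le (c := 0) ht (by
    filter_upwards [h.deriv_L₀] with s hs hmem
    obtain ⟨v, hv, hd⟩ := hs hmem.1
    exact ⟨-v, by linarith [hv.1.1], hd.fun_neg⟩)
  linarith

/-- The right-hand side of the first state equation is continuous, so this equation holds at every
time and not just almost everywhere. -/
theorem IsAdaptiveSolution.hasDerivWithinAt_fst
    (h : IsAdaptiveSolution m k₁ k₂ k₃ k₄ κ ε d x₁ x₂ L₀) (hm : 2 < m) (hL : 0 < L₀ 0) {t : ℝ}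
    (ht : 0 ≤ t) :
    HasDerivWithinAt x₁ (-((k₁ * ‖L₀ t • x₁ t‖ ^ (-(1 / m)) + k₂) • (L₀ t • x₁ t)) + x₂ t)
      (Ici 0) t := by
  have hpos : ∀ s, 0 ≤ s → 0 < L₀ s := fun s hs => hL.trans_le (h.le_gain hs)
  have hθ : 0 < 1 / m := by positivity
  have hθ' : 1 / m < 1 := by rw [div_lt_one] <;> linarith
  have hθ'' : 1 - 1 / m ≠ 0 := by linarith
  have hx₁ := continuousOn_Ici_of_absolutelyContinuous h.ac_x₁
  have hx₂ := continuousOn_Ici_of_absolutelyContinuous h.ac_x₂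
  have hL₀ := continuousOn_Ici_of_absolutelyContinuous h.ac_L₀
  -- `‖z‖ ^ (-θ) z` has norm `‖z‖ ^ (1 - θ)`, so it is continuous at the origin, too.
  have hfield : Continuous fun z : EuclideanSpace ℝ (Fin n) => ‖z‖ ^ (-(1 / m)) • z := by
    rw [continuous_iff_continuousAt]
    intro z
    by_cases hz : z = 0
    · subst hz
      have hnorm : Tendsto (fun z : EuclideanSpace ℝ (Fin n) => ‖z‖ ^ (1 - 1 / m)) (𝓝 0) (𝓝 0) := by
        have : Continuous fun z : EuclideanSpace ℝ (Fin n) => ‖z‖ ^ (1 - 1 / m) :=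
          continuous_norm.rpow_const fun _ => Or.inr (by linarith)
        have := this.tendsto 0
        rwa [norm_zero, Real.zero_rpow hθ''] at this
      rw [ContinuousAt, smul_zero]
      refine squeeze_zero_norm (fun z => ?_) hnorm
      rw [norm_smul, Real.norm_of_nonneg (by positivity)]
      by_cases hz : z = 0
      · rw [hz, norm_zero, mul_zero, Real.zero_rpow hθ'']
      · rw [← Real.rpow_add_one (norm_ne_zero_iff.2 hz)]
        exact le_of_eq (by congr 1; ring)
    · exact (continuousAt_id.norm.rpow_const (Or.inl (norm_ne_zero_iff.2 hz))).smul continuousAt_id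
  have hz : ContinuousOn (fun s => L₀ s • x₁ s) (Ici 0) := hL₀.smul hx₁
  refine hasDerivWithinAt_of_ae_of_continuousOn
    (g := fun t => -((k₁ * ‖L₀ t • x₁ t‖ ^ (-(1 / m)) + k₂) • (L₀ t • x₁ t)) + x₂ t)
    h.ac_x₁ ?_ ?_ ht
  · have hw := hfield.comp_continuousOn hz
    refine (((hw.const_smul k₁).add (hz.const_smul k₂)).neg.add hx₂).congr fun s _ => ?_
    simp only [Pi.add_apply, Pi.neg_apply, Function.comp_apply, Pi.smul_apply]
    module
  · filter_upwards [h.deriv_x₁] with s hs hs0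
    refine (hs hs0).congr_deriv ?_
    rw [smul_smul (gain1 m k₁ (L₀ s)), gain1_mul_inv_rpow hm (hpos s hs0), gain2]
    module

/-- Along a solution, the time to go of the weighted Lyapunov function decreases at a constant rate
as long as that function exceeds the threshold `B` created by the disturbance. -/
theorem IsAdaptiveSolution.timeToGo_le
    (h : IsAdaptiveSolution m k₁ k₂ k₃ k₄ κ ε d x₁ x₂ L₀) {A c γ μ δ : ℝ} (hm : 2 < m)
    (hk₃ : 0 < k₃) (hk₄ : 0 < k₄) (hL : 0 < L₀ 0)
    (hγ : 0 < γ) (hγ' : γ < 1) (hA : 0 < A) (hc : 0 < c) (hAc : 864 * κ ≤ A ^ 2 * c)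
    (hcomp : ∀ z₁ z₂ : EuclideanSpace ℝ (Fin n),
      energy (1 / m) k₃ k₄ z₁ z₂ ≤ 2 * lyapunov (1 / m) k₃ k₄ γ μ z₁ z₂ ∧
        lyapunov (1 / m) k₃ k₄ γ μ z₁ z₂ ≤ 2 * energy (1 / m) k₃ k₄ z₁ z₂)
    (hdecay : ∀ (z₁ z₂ d : EuclideanSpace ℝ (Fin n)) (L l δ : ℝ),
      0 < energy (1 / m) k₃ k₄ z₁ z₂ → 0 ≤ L → 0 ≤ l → ‖d‖ ≤ δ →
        lyapunovDeriv (1 / m) k₃ k₄ γ μ z₁ z₂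
          (L • (z₂ - (k₁ * ‖z₁‖ ^ (-(1 / m)) + k₂) • z₁) + l • z₁)
          (d - (L * (k₃ * (‖z₁‖ ^ (-(1 / m))) ^ 2 + k₄)) • z₁) ≤
        -c * L * ((1 + energy (1 / m) k₃ k₄ z₁ z₂ ^ (-γ)) * energy (1 / m) k₃ k₄ z₁ z₂)
          + l * (3 * energy (1 / m) k₃ k₄ z₁ z₂)
          + 3 * δ * Real.sqrt (energy (1 / m) k₃ k₄ z₁ z₂))
    (hδ : 0 ≤ δ) (hd : ∀ t : ℝ, 0 ≤ t → ‖d t‖ ≤ δ) {B : ℝ}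
    (hB : B = (40 * δ * Real.exp (A / L₀ 0) / (c * L₀ 0)) ^ 2)
    {t : ℝ} (ht : timeToGo γ (Real.exp (A / L₀ 0)
      * lyapunov (1 / m) k₃ k₄ γ μ (L₀ 0 • x₁ 0) (x₂ 0)) / (c * L₀ 0 / 8 * γ) ≤ t) :
    Real.exp (A / L₀ t) * lyapunov (1 / m) k₃ k₄ γ μ (L₀ t • x₁ t) (x₂ t) ≤ B := by
  have hθ : 0 < 1 / m := by positivity
  have hθ' : 1 / m < 1 / 2 := one_div_lt_one_div_of_lt (by norm_num) hm
  have hpos : ∀ s, 0 ≤ s → 0 < L₀ s := fun s hs => hL.trans_le (h.le_gain hs)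
  have hnn : ∀ z₁ z₂ : EuclideanSpace ℝ (Fin n), 0 ≤ lyapunov (1 / m) k₃ k₄ γ μ z₁ z₂ :=
    fun z₁ z₂ => by
      linarith [(hcomp z₁ z₂).1, energy_nonneg hk₃ hk₄ (by linarith : 1 / m < 1) z₁ z₂]
  have hx₁ := continuousOn_Ici_of_absolutelyContinuous h.ac_x₁
  have hx₂ := continuousOn_Ici_of_absolutelyContinuous h.ac_x₂
  have hL₀ := continuousOn_Ici_of_absolutelyContinuous h.ac_L₀
  refine le_of_decreasing_above (S := timeToGo γ) (α := c * L₀ 0 / 8 * γ)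
    (f := fun t => Real.exp (A / L₀ t) * lyapunov (1 / m) k₃ k₄ γ μ (L₀ t • x₁ t) (x₂ t))
    (hB ▸ sq_nonneg _) (by positivity) ?_ (fun s _ => mul_nonneg (Real.exp_nonneg _) (hnn _ _))
    (continuousOn_timeToGo hγ) (strictMonoOn_timeToGo hγ) (timeToGo_zero hγ) ?_ ht
  · have hV := continuous_lyapunov hk₃ hk₄ hθ' fun z₁ z₂ => ⟨hnn z₁ z₂, (hcomp z₁ z₂).2⟩
    have hz : ContinuousOn (fun s => (L₀ s • x₁ s, x₂ s)) (Ici 0) := (hL₀.smul hx₁).prodMk hx₂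
    have hVz : ContinuousOn (fun s => lyapunov (1 / m) k₃ k₄ γ μ (L₀ s • x₁ s) (x₂ s)) (Ici 0) := by
      have := hV.comp_continuousOn' hz
      exact this
    have hexp : ContinuousOn (fun s => Real.exp (A / L₀ s)) (Ici 0) :=
      (continuousOn_const.div hL₀ fun s hs => (hpos s hs).ne').rexp
    exact hexp.mul hVz
  · intro a b ha hab hgt
    have hE : ∀ s ∈ Icc a b, 0 < energy (1 / m) k₃ k₄ (L₀ s • x₁ s) (x₂ s) := by
      intro s hs
      have h1 : 0 < Real.exp (A / L₀ s) * lyapunov (1 / m) k₃ k₄ γ μ (L₀ s • x₁ s) (x₂ s) :=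
        (hB ▸ sq_nonneg _ : 0 ≤ B).trans_lt (hgt s hs)
      linarith [(hcomp (L₀ s • x₁ s) (x₂ s)).2, pos_of_mul_pos_right h1 (Real.exp_nonneg _)]
    have hsub : uIcc a b ⊆ uIcc 0 b := by
      rw [uIcc_of_le hab, uIcc_of_le (ha.trans hab)]; exact Icc_subset_Icc_left ha
    have hac : AbsolutelyContinuousOnInterval (fun s => ((x₁ s, x₂ s), L₀ s)) a b :=
      (((h.ac_x₁ b (ha.trans hab)).prodMk (h.ac_x₂ b (ha.trans hab))).prodMk
        (h.ac_L₀ b (ha.trans hab))).mono hsub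
    have hacS := hac.comp_of_contDiffAt
      (Φ := fun y => timeToGo γ (Real.exp (A / y.2)
        * lyapunov (1 / m) k₃ k₄ γ μ (y.2 • y.1.1) y.1.2)) (by
      intro s hs
      rw [uIcc_of_le hab] at hs
      have hW : ContDiffAt ℝ 1 (fun y : (EuclideanSpace ℝ (Fin n) × EuclideanSpace ℝ (Fin n)) × ℝ =>
          Real.exp (A / y.2) * lyapunov (1 / m) k₃ k₄ γ μ (y.2 • y.1.1) y.1.2)
          ((x₁ s, x₂ s), L₀ s) := by
        refine ContDiffAt.mul ?_ ?_
        · exact (contDiffAt_const.div contDiffAt_snd (hpos s (ha.trans hs.1)).ne').exp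
        · exact (contDiffAt_lyapunov hθ' (y := (L₀ s • x₁ s, x₂ s)) (hE s hs)).comp
            ((x₁ s, x₂ s), L₀ s)
            (f := fun y : (EuclideanSpace ℝ (Fin n) × EuclideanSpace ℝ (Fin n)) × ℝ =>
              (y.2 • y.1.1, y.1.2)) (by fun_prop)
      have hW0 : 0 < Real.exp (A / L₀ s) * lyapunov (1 / m) k₃ k₄ γ μ (L₀ s • x₁ s) (x₂ s) :=
        (hB ▸ sq_nonneg _ : 0 ≤ B).trans_lt (hgt s hs)
      unfold timeToGo
      exact (contDiffAt_const.add (hW.rpow_const_of_ne hW0.ne')).log (by positivity))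
    have := hacS.sub_le_mul_of_ae_hasDerivAt_le (c := -(c * L₀ 0 / 8 * γ)) hab (by
      filter_upwards [h.deriv_x₁, h.deriv_x₂, h.deriv_L₀] with s h₁ h₂ h₃ hs
      have hs0 : 0 ≤ s := ha.trans hs.1
      obtain ⟨v, hv, h₃⟩ := h₃ hs0
      have h₁ := h₁ hs0
      have h₂ := h₂ hs0
      have hLs := hpos s hs0
      have hz := h₃.fun_smul h₁
      rw [rescaled_field_fst hm hLs] at hz
      rw [rescaled_field_snd hm hLs] at h₂
      have hV := hasDerivAt_lyapunov (γ := γ) (μ := μ) hθ hθ' hz h₂ (hE s hs)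
      have hexp : HasDerivAt (fun s => Real.exp (A / L₀ s))
          (Real.exp (A / L₀ s) * (-(A * v / L₀ s ^ 2))) s := by
        refine (((hasDerivAt_const s A).fun_div h₃ hLs.ne').exp).congr_deriv ?_
        ring
      have hW0 : 0 < Real.exp (A / L₀ s) * lyapunov (1 / m) k₃ k₄ γ μ (L₀ s • x₁ s) (x₂ s) :=
        (hB ▸ sq_nonneg _ : 0 ≤ B).trans_lt (hgt s hs)
      refine hasDerivAt_timeToGo hγ (hexp.fun_mul hV) hW0 ?_
      have hw := weighted_decay hA hc hAc hL (h.le_gain hs0) hv.1.1 hv.1.2 hδ hγ hγ'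
        (hE s hs) (hcomp _ _).1 (hcomp _ _).2
        (hdecay _ _ _ _ _ δ (hE s hs) hLs.le (div_nonneg hv.1.1 hLs.le) (hd s hs0))
        (hB ▸ hgt s hs)
      refine le_trans (le_of_eq ?_) hw
      ring)
    linarith

end Solutions

/-! ### The settling time -/

/-- The time to go of a quantity bounded by the energy of an initial state of size `r` is a fast
settling time, up to the choice of constants: with `σ = r ^ θ`, the energy to the power `γ` is at
most a multiple of `σ (1 + σ)`. -/
theorem timeToGo_div_le_fastSettlingTime {θ γ N α r w : ℝ} (hθ : 0 < θ) (hθ' : θ < 1 / 2)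
    (hγ : γ = θ / (2 - 2 * θ)) (hN : 0 ≤ N) (hα : 0 < α) (hr : 0 ≤ r) (hw0 : 0 ≤ w)
    (hw : w ≤ N * (r ^ (2 - 2 * θ) + r ^ 2)) :
    timeToGo γ w / α ≤ fastSettlingTime (α / (2 * θ) / (N ^ γ + 1)) (α / (2 * θ)) (1 - θ) r := by
  have hden : 0 < 2 - 2 * θ := by linarith
  have hγ0 : 0 < γ := by rw [hγ]; exact div_pos hθ hden
  have hγ1 : 2 * γ ≤ 1 := by
    rw [hγ, mul_div_assoc', div_le_one hden]; linarith
  obtain ⟨σ, hσ⟩ : ∃ x, x = r ^ θ := ⟨_, rfl⟩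
  have hσ0 : 0 ≤ σ := by rw [hσ]; positivity
  have e1 : r ^ (2 - 2 * θ) + r ^ 2 = r ^ (2 - 2 * θ) * (1 + σ ^ 2) := by
    have h2 : r ^ 2 = r ^ (2 - 2 * θ) * σ ^ 2 := by
      rw [hσ, ← Real.rpow_natCast, ← Real.rpow_natCast (r ^ θ), ← Real.rpow_mul hr,
        ← Real.rpow_add' hr (by push_cast; linarith)]
      congr 1; push_cast; ring
    rw [h2]; ring
  have e2 : (r ^ (2 - 2 * θ)) ^ γ = σ := by
    rw [← Real.rpow_mul hr, hγ, mul_div_cancel₀ _ hden.ne', hσ]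
  have e3 : (1 + σ ^ 2) ^ γ ≤ 1 + σ := by
    calc (1 + σ ^ 2) ^ γ ≤ ((1 + σ) ^ 2) ^ γ := by gcongr; nlinarith
      _ = (1 + σ) ^ (2 * γ) := by
        rw [← Real.rpow_natCast, ← Real.rpow_mul (by linarith)]; norm_num
      _ ≤ 1 + σ := Real.rpow_le_self_of_one_le (by linarith) hγ1
  have hNγ : 0 ≤ N ^ γ := by positivity
  have e4 : w ^ γ ≤ N ^ γ * (σ * (1 + σ)) := by
    calc w ^ γ ≤ (N * (r ^ (2 - 2 * θ) * (1 + σ ^ 2))) ^ γ := by rw [← e1]; gcongr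
      _ = N ^ γ * ((r ^ (2 - 2 * θ)) ^ γ * (1 + σ ^ 2) ^ γ) := by
        rw [Real.mul_rpow hN (by positivity), Real.mul_rpow (by positivity) (by positivity)]
      _ ≤ N ^ γ * (σ * (1 + σ)) := by rw [e2]; gcongr
  have e5 : timeToGo γ w ≤ 2 * Real.log (1 + (N ^ γ + 1) * σ) := by
    have : 2 * Real.log (1 + (N ^ γ + 1) * σ) = Real.log ((1 + (N ^ γ + 1) * σ) ^ 2) := by
      rw [Real.log_pow]; norm_num
    rw [this, timeToGo]
    refine Real.log_le_log (by positivity) ?_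
    have h1 : 0 ≤ (N ^ γ + 2) * σ := by positivity
    have h2 : 0 ≤ (N ^ γ * N ^ γ + N ^ γ + 1) * σ ^ 2 := by positivity
    linarith
  have e6 : α / (2 * θ) * r ^ (1 - (1 - θ)) / (α / (2 * θ) / (N ^ γ + 1)) = (N ^ γ + 1) * σ := by
    rw [sub_sub_cancel, ← hσ]
    field_simp
  rw [fastSettlingTime, e6, sub_sub_cancel]
  have e7 : α / (2 * θ) * θ = α / 2 := by field_simp
  rw [e7, div_le_div_iff₀ hα (by positivity)]
  nlinarith

theorem energy_smul_le {F : Type*} [NormedAddCommGroup F] [NormedSpace ℝ F] {θ k₃ k₄ ℓ r : ℝ}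
    (hθ : θ < 1) (hk₃ : 0 < k₃) (hk₄ : 0 < k₄) (hℓ : 0 < ℓ) {x₁ x₂ : F} (h₁ : ‖x₁‖ ≤ r)
    (h₂ : ‖x₂‖ ≤ r) :
    energy θ k₃ k₄ (ℓ • x₁) x₂ ≤
      (1 / 2 + k₃ / (2 - 2 * θ) * ℓ ^ (2 - 2 * θ) + k₄ / 2 * ℓ ^ 2)
        * (r ^ (2 - 2 * θ) + r ^ 2) := by
  have hr : 0 ≤ r := (norm_nonneg _).trans h₁
  have hden : 0 < 2 - 2 * θ := by linarith
  have hα : 0 < k₃ / (2 - 2 * θ) := div_pos hk₃ hden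
  have a1 : ‖x₁‖ ^ (2 - 2 * θ) ≤ r ^ (2 - 2 * θ) := by gcongr
  have a2 : ‖x₁‖ ^ 2 ≤ r ^ 2 := by gcongr
  have a3 : ‖x₂‖ ^ 2 ≤ r ^ 2 := by gcongr
  have b1 : 0 ≤ r ^ (2 - 2 * θ) := by positivity
  have c1 : k₃ / (2 - 2 * θ) * ℓ ^ (2 - 2 * θ) * ‖x₁‖ ^ (2 - 2 * θ) ≤
      k₃ / (2 - 2 * θ) * ℓ ^ (2 - 2 * θ) * (r ^ (2 - 2 * θ) + r ^ 2) := by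
    gcongr; nlinarith
  have c2 : k₄ / 2 * ℓ ^ 2 * ‖x₁‖ ^ 2 ≤ k₄ / 2 * ℓ ^ 2 * (r ^ (2 - 2 * θ) + r ^ 2) := by
    gcongr; nlinarith
  rw [energy, norm_smul, Real.norm_of_nonneg hℓ.le, Real.mul_rpow hℓ.le (norm_nonneg _), mul_pow]
  nlinarith

/-- Fast convergence of the rescaled state to a ball given by an energy level, which is zero if
there is no disturbance. -/
theorem exists_energy_le {n : ℕ} {m k₁ k₂ k₃ k₄ κ ε ℓ δ : ℝ}
    (hm : 2 < m) (hk₁ : 0 < k₁) (hk₂ : 0 < k₂) (hk₃ : 0 < k₃) (hk₄ : 0 < k₄)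
    (hκ : 0 < κ) (hℓ : 0 < ℓ) (hδ : 0 ≤ δ) :
    ∃ B c₁ c₂ p : ℝ, 0 ≤ B ∧ (δ = 0 → B = 0) ∧ 0 < c₁ ∧ 0 < c₂ ∧ 0 < p ∧ p < 1 ∧
      ∀ d : ℝ → EuclideanSpace ℝ (Fin n), (∀ t : ℝ, 0 ≤ t → ‖d t‖ ≤ δ) →
      ∀ (x₁ x₂ : ℝ → EuclideanSpace ℝ (Fin n)) (L₀ : ℝ → ℝ),
        IsAdaptiveSolution m k₁ k₂ k₃ k₄ κ ε d x₁ x₂ L₀ → L₀ 0 = ℓ →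
        ∀ t : ℝ, fastSettlingTime c₁ c₂ p (stateNorm (x₁ 0) (x₂ 0)) ≤ t →
          0 ≤ t ∧ energy (1 / m) k₃ k₄ (L₀ t • x₁ t) (x₂ t) ≤ B := by
  obtain ⟨θ, hθm⟩ : ∃ x, x = 1 / m := ⟨_, rfl⟩
  have hθ : 0 < θ := by rw [hθm]; positivity
  have hθ' : θ < 1 / 2 := hθm ▸ one_div_lt_one_div_of_lt (by norm_num) hm
  obtain ⟨γ, hγ⟩ : ∃ x, x = θ / (2 - 2 * θ) := ⟨_, rfl⟩
  have hden : 0 < 2 - 2 * θ := by linarith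
  have hγ0 : 0 < γ := by rw [hγ]; exact div_pos hθ hden
  have hγ1 : γ < 1 := by rw [hγ, div_lt_one hden]; linarith
  obtain ⟨μ, c, hc, hcomp, hdecay⟩ := exists_lyapunov_decay (EuclideanSpace ℝ (Fin n))
    hk₁ hk₂ hk₃ hk₄ hθ hθ' hγ
  obtain ⟨A, hAdef⟩ : ∃ x, x = 1 + 864 * κ / c := ⟨_, rfl⟩
  have hA1 : 1 ≤ A := by rw [hAdef]; linarith [(by positivity : 0 ≤ 864 * κ / c)]
  have hAc : 864 * κ ≤ A ^ 2 * c := by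
    have h1 : 864 * κ ≤ A * c := by rw [hAdef, add_mul, div_mul_cancel₀ _ hc.ne']; linarith
    have h2 : A * c ≤ A ^ 2 * c := by gcongr; nlinarith
    linarith
  obtain ⟨N, hN⟩ : ∃ x, x = Real.exp (A / ℓ) * (2 *
    (1 / 2 + k₃ / (2 - 2 * θ) * ℓ ^ (2 - 2 * θ) + k₄ / 2 * ℓ ^ 2)) := ⟨_, rfl⟩
  have hN0 : 0 ≤ N := by
    have : 0 < k₃ / (2 - 2 * θ) := div_pos hk₃ hden
    rw [hN]; positivity
  have hα : 0 < c * ℓ / 8 * γ := by positivity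
  have hNγ : 0 ≤ N ^ γ := by positivity
  refine ⟨2 * (40 * δ * Real.exp (A / ℓ) / (c * ℓ)) ^ 2,
    c * ℓ / 8 * γ / (2 * θ) / (N ^ γ + 1), c * ℓ / 8 * γ / (2 * θ), 1 - θ, by positivity,
    fun h0 => by rw [h0]; simp, by positivity, by positivity, by linarith, by linarith, ?_⟩
  intro d hd x₁ x₂ L₀ hsol hL t ht
  have hr : 0 ≤ stateNorm (x₁ 0) (x₂ 0) := Real.sqrt_nonneg _
  have hr₁ : ‖x₁ 0‖ ≤ stateNorm (x₁ 0) (x₂ 0) :=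
    Real.le_sqrt_of_sq_le (by linarith [sq_nonneg ‖x₂ 0‖])
  have hr₂ : ‖x₂ 0‖ ≤ stateNorm (x₁ 0) (x₂ 0) :=
    Real.le_sqrt_of_sq_le (by linarith [sq_nonneg ‖x₁ 0‖])
  have hV0 : ∀ z₁ z₂ : EuclideanSpace ℝ (Fin n), 0 ≤ lyapunov θ k₃ k₄ γ μ z₁ z₂ :=
    fun z₁ z₂ => by
      linarith [(hcomp z₁ z₂).1, energy_nonneg hk₃ hk₄ (by linarith : θ < 1) z₁ z₂]
  have hinit : Real.exp (A / ℓ) * lyapunov θ k₃ k₄ γ μ (ℓ • x₁ 0) (x₂ 0) ≤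
      N * (stateNorm (x₁ 0) (x₂ 0) ^ (2 - 2 * θ) + stateNorm (x₁ 0) (x₂ 0) ^ 2) := by
    have h1 := (hcomp (ℓ • x₁ 0) (x₂ 0)).2
    have h2 := energy_smul_le (by linarith : θ < 1) hk₃ hk₄ hℓ hr₁ hr₂
    rw [hN, mul_assoc, mul_assoc]
    gcongr
    linarith
  have hsettle := (timeToGo_div_le_fastSettlingTime hθ hθ' hγ hN0 hα hr
    (mul_nonneg (Real.exp_nonneg _) (hV0 _ _)) hinit).trans ht
  have ht0 : 0 ≤ t := by
    refine le_trans (div_nonneg ?_ hα.le) hsettle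
    exact Real.log_nonneg (le_add_of_nonneg_right
      (Real.rpow_nonneg (mul_nonneg (Real.exp_nonneg _) (hV0 _ _)) _))
  refine ⟨ht0, ?_⟩
  subst hL
  have hLt : 0 < L₀ t := hℓ.trans_le (hsol.le_gain ht0)
  rw [hθm] at hcomp hdecay hsettle hV0
  have hfin := hsol.timeToGo_le hm hk₃ hk₄ hℓ hγ0 hγ1 (by linarith) hc hAc hcomp hdecay hδ hd
    rfl hsettle
  have h1 : lyapunov (1 / m) k₃ k₄ γ μ (L₀ t • x₁ t) (x₂ t) ≤
      Real.exp (A / L₀ t) * lyapunov (1 / m) k₃ k₄ γ μ (L₀ t • x₁ t) (x₂ t) :=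
    le_mul_of_one_le_left (hV0 _ _) (Real.one_le_exp (by positivity))
  linarith [(hcomp (L₀ t • x₁ t) (x₂ t)).1]

theorem proposition1 (n : ℕ) (m k₁ k₂ k₃ k₄ κ ε ℓ : ℝ)
    (hm : 2 < m) (hk₁ : 0 < k₁) (hk₂ : 0 < k₂) (hk₃ : 0 < k₃) (hk₄ : 0 < k₄)
    (hk : (m ^ 3 * k₃ / (m - 1) + (4 * m ^ 2 - 4 * m + 1) * k₁ ^ 2) * k₂ ^ 2 < m ^ 2 * k₃ * k₄)
    (hκ : 0 < κ) (hε : 0 < ε) (hℓ : 0 < ℓ) :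
    -- (i) without disturbance: fast finite-time convergence to the origin
    (∃ c₁ c₂ p : ℝ, 0 < c₁ ∧ 0 < c₂ ∧ 0 < p ∧ p < 1 ∧
      ∀ (x₁ x₂ : ℝ → EuclideanSpace ℝ (Fin n)) (L₀ : ℝ → ℝ),
        IsAdaptiveSolution m k₁ k₂ k₃ k₄ κ ε (fun _ => 0) x₁ x₂ L₀ → L₀ 0 = ℓ →
        ∀ t : ℝ, fastSettlingTime c₁ c₂ p (stateNorm (x₁ 0) (x₂ 0)) ≤ t →
          x₁ t = 0 ∧ HasDerivWithinAt x₁ 0 (Set.Ici 0) t) ∧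
    -- (ii) bounded disturbance: fast finite-time uniform ultimate boundedness
    (∀ δ : ℝ, 0 ≤ δ →
      ∃ b c₁ c₂ p : ℝ, 0 < b ∧ 0 < c₁ ∧ 0 < c₂ ∧ 0 < p ∧ p < 1 ∧
        ∀ d : ℝ → EuclideanSpace ℝ (Fin n), (∀ t : ℝ, 0 ≤ t → ‖d t‖ ≤ δ) →
        ∀ (x₁ x₂ : ℝ → EuclideanSpace ℝ (Fin n)) (L₀ : ℝ → ℝ),
          IsAdaptiveSolution m k₁ k₂ k₃ k₄ κ ε d x₁ x₂ L₀ → L₀ 0 = ℓ →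
          ∀ t : ℝ, fastSettlingTime c₁ c₂ p (stateNorm (x₁ 0) (x₂ 0)) ≤ t →
            ‖x₁ t‖ ≤ b ∧ ∃ v, HasDerivWithinAt x₁ v (Set.Ici 0) t ∧ ‖v‖ ≤ b) := by
  have hθ : 1 / m < 1 := by rw [div_lt_one] <;> linarith
  constructor
  · obtain ⟨B, c₁, c₂, p, -, hB, hc₁, hc₂, hp, hp', H⟩ :=
      exists_energy_le (n := n) (ε := ε) hm hk₁ hk₂ hk₃ hk₄ hκ hℓ le_rfl
    refine ⟨c₁, c₂, p, hc₁, hc₂, hp, hp', fun x₁ x₂ L₀ hsol hL t ht => ?_⟩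
    obtain ⟨ht0, hE⟩ := H (fun _ => 0) (fun _ _ => by simp) x₁ x₂ L₀ hsol hL t ht
    rw [hB rfl] at hE
    have hLt : 0 < L₀ t := hℓ.trans_le (hL ▸ hsol.le_gain ht0)
    obtain ⟨h1, h2⟩ := sq_norm_le_energy hk₃ hk₄ hθ (L₀ t • x₁ t) (x₂ t)
    have hz₁ : L₀ t • x₁ t = 0 := by
      rw [← norm_eq_zero, ← sq_eq_zero_iff]
      exact le_antisymm (nonpos_of_mul_nonpos_right (h1.trans hE) (half_pos hk₄)) (sq_nonneg _)
    have hz₂ : x₂ t = 0 := by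
      rw [← norm_eq_zero, ← sq_eq_zero_iff]
      exact le_antisymm (by linarith) (sq_nonneg _)
    have hd := hsol.hasDerivWithinAt_fst hm (hL ▸ hℓ) ht0
    rw [hz₁, hz₂, smul_zero, neg_zero, zero_add] at hd
    exact ⟨(smul_eq_zero.1 hz₁).resolve_left hLt.ne', hd⟩
  · intro δ hδ
    obtain ⟨B, c₁, c₂, p, hB0, -, hc₁, hc₂, hp, hp', H⟩ :=
      exists_energy_le (n := n) (ε := ε) hm hk₁ hk₂ hk₃ hk₄ hκ hℓ hδ
    obtain ⟨R₁, hR₁⟩ : ∃ x, x = Real.sqrt (2 / k₄ * B) := ⟨_, rfl⟩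
    obtain ⟨R₂, hR₂⟩ : ∃ x, x = Real.sqrt (2 * B) := ⟨_, rfl⟩
    have hR₁0 : 0 ≤ R₁ := hR₁ ▸ Real.sqrt_nonneg _
    have hR₂0 : 0 ≤ R₂ := hR₂ ▸ Real.sqrt_nonneg _
    have hp₁ : 0 ≤ R₁ / ℓ := by positivity
    have hp₂ : 0 ≤ k₁ * R₁ ^ (1 - 1 / m) + k₂ * R₁ + R₂ := by positivity
    refine ⟨R₁ / ℓ + (k₁ * R₁ ^ (1 - 1 / m) + k₂ * R₁ + R₂) + 1, c₁, c₂, p, by linarith,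
      hc₁, hc₂, hp, hp', fun d hd x₁ x₂ L₀ hsol hL t ht => ?_⟩
    obtain ⟨ht0, hE⟩ := H d hd x₁ x₂ L₀ hsol hL t ht
    have hℓL : ℓ ≤ L₀ t := hL ▸ hsol.le_gain ht0
    obtain ⟨h1, h2⟩ := sq_norm_le_energy hk₃ hk₄ hθ (L₀ t • x₁ t) (x₂ t)
    have hz₁ : ‖L₀ t • x₁ t‖ ≤ R₁ := by
      rw [hR₁]
      refine Real.le_sqrt_of_sq_le ?_
      rw [div_mul_eq_mul_div, le_div_iff₀ hk₄]
      linarith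
    have hz₂ : ‖x₂ t‖ ≤ R₂ := by
      rw [hR₂]
      exact Real.le_sqrt_of_sq_le (by linarith)
    refine ⟨?_, _, hsol.hasDerivWithinAt_fst hm (hL ▸ hℓ) ht0, ?_⟩
    · have : ‖x₁ t‖ ≤ R₁ / ℓ := by
        rw [le_div_iff₀ hℓ, mul_comm]
        rw [norm_smul, Real.norm_of_nonneg (hℓ.le.trans hℓL)] at hz₁
        exact (mul_le_mul_of_nonneg_right hℓL (norm_nonneg _)).trans hz₁
      linarith
    · obtain ⟨z, hz⟩ : ∃ z, z = L₀ t • x₁ t := ⟨_, rfl⟩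
      rw [← hz] at hz₁ ⊢
      have hw : ‖z‖ ^ (-(1 / m)) * ‖z‖ = ‖z‖ ^ (1 - 1 / m) := by
        rw [← Real.rpow_add_one' (norm_nonneg z) (by linarith)]
        congr 1; ring
      have hzp : ‖z‖ ^ (1 - 1 / m) ≤ R₁ ^ (1 - 1 / m) :=
        Real.rpow_le_rpow (norm_nonneg z) hz₁ (by linarith)
      calc ‖-((k₁ * ‖z‖ ^ (-(1 / m)) + k₂) • z) + x₂ t‖
          ≤ ‖(k₁ * ‖z‖ ^ (-(1 / m)) + k₂) • z‖ + ‖x₂ t‖ := by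
            rw [← norm_neg ((k₁ * ‖z‖ ^ (-(1 / m)) + k₂) • z)]
            exact norm_add_le _ _
        _ = k₁ * (‖z‖ ^ (-(1 / m)) * ‖z‖) + k₂ * ‖z‖ + ‖x₂ t‖ := by
            rw [norm_smul, Real.norm_of_nonneg (by positivity)]; ring
        _ ≤ k₁ * R₁ ^ (1 - 1 / m) + k₂ * R₁ + R₂ := by rw [hw]; gcongr
        _ ≤ _ := by linarith
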